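/- Let $\ell$ be a prime number. A discrete group $\Gamma$ is called $\ell$-regular if every finite quotient of $\Gamma$ that is an $\ell$-group is a quotient of a torsion free nilpotent quotient of $\Gamma$; that is, for every normal subgroup $N$ of $\Gamma$ such that $\Gamma/N$ is a finite $\ell$-group there is a normal subgroup $M\subseteq N$ of $\Gamma$ such that $\Gamma/M$ is nilpotent and torsion free. Denote by $\Gamma^{(\ell)}$ the pro-$\ell$ completion of $\Gamma$, i.e. the inverse limit of the quotients of $\Gamma$ that are finite $\ell$-groups, with its profinite topology. Denote by $\Gamma^{\mathrm{un}}$ the unipotent (Malcev) completion of $\Gamma$ over $\mathbb{Q}$, i.e. the tannakian fundamental group (tensor automorphisms of the forgetful functor) of the category of finite dimensional unipotent representations of $\Gamma$ over $\mathbb{Q}$. Its group of $\mathbb{Q}_\ell$-points $\Gamma^{\mathrm{un}}(\mathbb{Q}_\ell)$ carries the coarsest topology for which all matrix coefficients $\Gamma^{\mathrm{un}}(\mathbb{Q}_\ell)\to\mathbb{Q}_\ell$ are continuous. **Proposition.** If $\Gamma$ is a finitely generated $\ell$-regular group, then there is a unique continuous homomorphism $\Gamma^{(\ell)}\to\Gamma^{\mathrm{un}}(\mathbb{Q}_\ell)$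 whose composition with the natural map $\Gamma\to\Gamma^{(\ell)}$ is the natural map $\Gamma\to\Gamma^{\mathrm{un}}(\mathbb{Q}_\ell)$, and this homomorphism is injective. -/

import Mathlib

open scoped TensorProduct

universe u v w

/-! ### `ℓ`-regular groups -/

/-- A discrete group `Γ` is `ℓ`-regular if every finite quotient `Γ ⧸ N` that is an `ℓ`-group is a
quotient of a torsion free nilpotent quotient `Γ ⧸ M` of `Γ`. -/
def IsLRegular (ℓ : ℕ) (Γ : Type v) [Group Γ] : Prop :=
  ∀ (N : Subgroup Γ) [N.Normal], Finite (Γ ⧸ N) → IsPGroup ℓ (Γ ⧸ N) →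
    ∃ (M : Subgroup Γ) (_ : M.Normal), M ≤ N ∧ Group.IsNilpotent (Γ ⧸ M) ∧
      ∀ x : Γ ⧸ M, IsOfFinOrder x → x = 1

/-! ### Pro-`ℓ` completion -/

/-- The normal subgroups `N` of `Γ` such that `Γ ⧸ N` is a finite `ℓ`-group. -/
structure LIndex (ℓ : ℕ) (Γ : Type v) [Group Γ] where
  N : Subgroup Γ
  normal : N.Normal
  finite : Finite (Γ ⧸ N)
  isPGroup : IsPGroup ℓ (Γ ⧸ N)

attribute [instance] LIndex.normal

/-- The pro-`ℓ` completion of a discrete group `Γ`: the inverse limit of the finite quotients of `Γ`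
that are `ℓ`-groups, as a subgroup of their product. -/
def ProLCompletion (ℓ : ℕ) (Γ : Type v) [Group Γ] : Subgroup (∀ i : LIndex ℓ Γ, Γ ⧸ i.N) where
  carrier := {x | ∀ (i j : LIndex ℓ Γ) (h : i.N ≤ j.N),
    QuotientGroup.map i.N j.N (MonoidHom.id Γ) h (x i) = x j}
  mul_mem' := by
    intro a b ha hb i j h
    simp only [Pi.mul_apply, map_mul, ha i j h, hb i j h]
  one_mem' := by
    intro i j h
    simp only [Pi.one_apply, map_one]
  inv_mem' := by
    intro a ha i j h
    simp only [Pi.inv_apply, map_inv, ha i j h]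

/-- The profinite topology: the coarsest one for which the projections to the discrete finite
quotients are continuous. -/
instance ProLCompletion.instTopologicalSpace (ℓ : ℕ) (Γ : Type v) [Group Γ] :
    TopologicalSpace (ProLCompletion ℓ Γ) :=
  ⨅ i : LIndex ℓ Γ, TopologicalSpace.induced (fun x => x.1 i) ⊥

/-- The natural homomorphism from `Γ` to its pro-`ℓ` completion. -/
def toProLCompletion (ℓ : ℕ) (Γ : Type v) [Group Γ] : Γ →* ProLCompletion ℓ Γ where
  toFun γ := ⟨fun i => (γ : Γ ⧸ i.N), fun _ _ _ => rfl⟩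
  map_one' := rfl
  map_mul' _ _ := rfl

/-! ### Unipotent representations -/

/-- A representation of `Γ` on `V` is unipotent if `V` has a finite filtration
`0 = I 0 ⊆ I 1 ⊆ ⋯ ⊆ I n = V` by subrepresentations such that `Γ` acts trivially on each graded
quotient. (Since `I` is increasing, the last condition forces each `I k` to be stable.) -/
def Representation.IsUnipotent {F : Type u} [Field F] {Γ : Type v} [Group Γ] {V : Type u}
    [AddCommGroup V] [Module F V] (ρ : Representation F Γ V) : Prop :=
  ∃ (I : ℕ → Submodule F V) (n : ℕ), Monotone I ∧ I 0 = ⊥ ∧ I n = ⊤ ∧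
    ∀ (k : ℕ) (γ : Γ), ∀ v ∈ I (k + 1), ρ γ v - v ∈ I k

theorem Representation.isUnipotent_trivial (F : Type u) [Field F] (Γ : Type v) [Group Γ] :
    (Representation.trivial F Γ F).IsUnipotent := by
  refine ⟨fun k => if k = 0 then ⊥ else ⊤, 1, ?_, by simp, by simp, ?_⟩
  · intro a b hab
    by_cases ha : a = 0
    · simp [ha]
    · have hb : b ≠ 0 := by omega
      simp [hb]
  · intro k γ v _
    simp

theorem Representation.IsUnipotent.tprod {F : Type u} [Field F] {Γ : Type v} [Group Γ]
    {V W : Type u} [AddCommGroup V] [Module F V] [AddCommGroup W] [Module F W]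
    {ρ : Representation F Γ V} {σ : Representation F Γ W}
    (hρ : ρ.IsUnipotent) (hσ : σ.IsUnipotent) : (ρ.tprod σ).IsUnipotent := by
  obtain ⟨I, n, hI, hI0, hIn, hIs⟩ := hρ
  obtain ⟨J, m, hJ, hJ0, hJm, hJs⟩ := hσ
  let K : ℕ → Submodule F (V ⊗[F] W) := fun k =>
    ⨆ p : {p : ℕ × ℕ // p.1 + p.2 ≤ k}, Submodule.map₂ (TensorProduct.mk F V W) (I p.1.1) (J p.1.2)
  have hK : ∀ (k i j : ℕ), i + j ≤ k → ∀ x ∈ I i, ∀ y ∈ J j, x ⊗ₜ[F] y ∈ K k := by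
    intro k i j h x hx y hy
    exact (le_iSup (fun p : {p : ℕ × ℕ // p.1 + p.2 ≤ k} =>
      Submodule.map₂ (TensorProduct.mk F V W) (I p.1.1) (J p.1.2)) ⟨(i, j), h⟩)
      (Submodule.apply_mem_map₂ _ hx hy)
  have hJst : ∀ (j : ℕ) (γ : Γ), ∀ y ∈ J j, σ γ y ∈ J j := by
    intro j γ y hy
    have h := hJs j γ y (hJ (Nat.le_succ j) hy)
    simpa using (J j).add_mem h hy
  refine ⟨K, n + m, ?_, ?_, ?_, ?_⟩
  · intro a b hab
    refine iSup_le fun p => Submodule.map₂_le.2 fun x hx y hy => ?_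
    exact hK b p.1.1 p.1.2 (p.2.trans hab) x hx y hy
  · refine le_bot_iff.1 (iSup_le fun p => Submodule.map₂_le.2 fun x hx y hy => ?_)
    have h0 : p.1.1 = 0 := by have := p.2; omega
    rw [h0, hI0, Submodule.mem_bot] at hx
    simp [hx]
  · refine top_le_iff.1 fun z _ => ?_
    induction z with
    | zero => exact (K (n + m)).zero_mem
    | tmul x y => exact hK _ n m le_rfl x (hIn ▸ Submodule.mem_top) y (hJm ▸ Submodule.mem_top)
    | add a b ha hb => exact (K (n + m)).add_mem (ha Submodule.mem_top) (hb Submodule.mem_top)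
  · intro k γ z hz
    suffices h : K (k + 1) ≤ (K k).comap ((ρ.tprod σ) γ - (LinearMap.id : V ⊗[F] W →ₗ[F] V ⊗[F] W)) by
      simpa using h hz
    refine iSup_le fun p => Submodule.map₂_le.2 fun x hx y hy => ?_
    obtain ⟨⟨i, j⟩, hp⟩ := p
    have e : ((ρ.tprod σ) γ - (LinearMap.id : V ⊗[F] W →ₗ[F] V ⊗[F] W)) (TensorProduct.mk F V W x y)
        = (ρ γ x - x) ⊗ₜ[F] σ γ y + x ⊗ₜ[F] (σ γ y - y) := by
      simp [TensorProduct.sub_tmul, TensorProduct.tmul_sub]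
    rw [Submodule.mem_comap, e]
    refine (K k).add_mem ?_ ?_
    · rcases i with _ | i
      · rw [hI0, Submodule.mem_bot] at hx
        simp [hx]
      · exact hK k i j (by simp only at hp; omega) _ (hIs i γ x hx) _ (hJst j γ y hy)
    · rcases j with _ | j
      · rw [hJ0, Submodule.mem_bot] at hy
        simp [hy]
      · exact hK k i j (by simp only at hp; omega) _ hx _ (hJs j γ y hy)

/-- The objects of the category of finite dimensional unipotent `F`-linear representations
of `Γ`. -/
structure UnipotentRep (F : Type u) [Field F] (Γ : Type v) [Group Γ] where
  V : Type u
  [addCommGroup : AddCommGroup V]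
  [module : Module F V]
  [finiteDimensional : FiniteDimensional F V]
  ρ : Representation F Γ V
  isUnipotent : ρ.IsUnipotent

namespace UnipotentRep

attribute [instance] addCommGroup module finiteDimensional

variable {F : Type u} [Field F] {Γ : Type v} [Group Γ]

/-- A linear map is a morphism of representations if it is `Γ`-equivariant. -/
def IsHom (A B : UnipotentRep F Γ) (f : A.V →ₗ[F] B.V) : Prop :=
  ∀ γ : Γ, f ∘ₗ A.ρ γ = B.ρ γ ∘ₗ f

/-- The unit object: the trivial one-dimensional representation. -/
abbrev unit (F : Type u) [Field F] (Γ : Type v) [Group Γ] : UnipotentRep F Γ where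
  V := F
  ρ := Representation.trivial F Γ F
  isUnipotent := Representation.isUnipotent_trivial F Γ

/-- The tensor product of two unipotent representations. -/
noncomputable abbrev tensor (A B : UnipotentRep F Γ) : UnipotentRep F Γ where
  V := A.V ⊗[F] B.V
  ρ := A.ρ.tprod B.ρ
  isUnipotent := A.isUnipotent.tprod B.isUnipotent

end UnipotentRep

/-! ### Unipotent completion -/

/-- The automorphism `t` of `R ⊗ (V ⊗ W)` is identified with `a ⊗ b` under the canonical isomorphism
`R ⊗ (V ⊗ W) ≃ (R ⊗ V) ⊗[R] (R ⊗ W)`. -/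
def IsTensorAut {F : Type u} [Field F] {R : Type w} [CommRing R] [Algebra F R]
    {V W : Type u} [AddCommGroup V] [Module F V] [AddCommGroup W] [Module F W]
    (a : (R ⊗[F] V) ≃ₗ[R] (R ⊗[F] V)) (b : (R ⊗[F] W) ≃ₗ[R] (R ⊗[F] W))
    (t : (R ⊗[F] (V ⊗[F] W)) ≃ₗ[R] (R ⊗[F] (V ⊗[F] W))) : Prop :=
  ∀ x : R ⊗[F] (V ⊗[F] W),
    TensorProduct.AlgebraTensorModule.distribBaseChange F R V W (t x) =
      TensorProduct.congr a b (TensorProduct.AlgebraTensorModule.distribBaseChange F R V W x)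

theorem isTensorAut_one {F : Type u} [Field F] {R : Type w} [CommRing R] [Algebra F R]
    {V W : Type u} [AddCommGroup V] [Module F V] [AddCommGroup W] [Module F W] :
    IsTensorAut (1 : (R ⊗[F] V) ≃ₗ[R] (R ⊗[F] V)) (1 : (R ⊗[F] W) ≃ₗ[R] (R ⊗[F] W)) 1 := by
  intro x
  exact (LinearMap.congr_fun TensorProduct.map_id _).symm

theorem IsTensorAut.mul {F : Type u} [Field F] {R : Type w} [CommRing R] [Algebra F R]
    {V W : Type u} [AddCommGroup V] [Module F V] [AddCommGroup W] [Module F W]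
    {a a' : (R ⊗[F] V) ≃ₗ[R] (R ⊗[F] V)} {b b' : (R ⊗[F] W) ≃ₗ[R] (R ⊗[F] W)}
    {t t' : (R ⊗[F] (V ⊗[F] W)) ≃ₗ[R] (R ⊗[F] (V ⊗[F] W))}
    (h : IsTensorAut a b t) (h' : IsTensorAut a' b' t') :
    IsTensorAut (a * a') (b * b') (t * t') := by
  intro x
  rw [LinearEquiv.mul_apply, h, h']
  exact (LinearMap.congr_fun (TensorProduct.map_comp a.toLinearMap b.toLinearMap
    a'.toLinearMap b'.toLinearMap) _).symm

theorem IsTensorAut.inv {F : Type u} [Field F] {R : Type w} [CommRing R] [Algebra F R]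
    {V W : Type u} [AddCommGroup V] [Module F V] [AddCommGroup W] [Module F W]
    {a : (R ⊗[F] V) ≃ₗ[R] (R ⊗[F] V)} {b : (R ⊗[F] W) ≃ₗ[R] (R ⊗[F] W)}
    {t : (R ⊗[F] (V ⊗[F] W)) ≃ₗ[R] (R ⊗[F] (V ⊗[F] W))}
    (h : IsTensorAut a b t) : IsTensorAut a⁻¹ b⁻¹ t⁻¹ := by
  intro x
  have h1 := h (t⁻¹ x)
  rw [show t (t⁻¹ x) = x from t.apply_symm_apply x] at h1
  rw [h1]
  exact ((TensorProduct.congr a b).symm_apply_apply _).symm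

/-- The group `Γ^un(R)` of `R`-points of the unipotent (Malcev) completion `Γ^un` of `Γ` over `F`,
constructed as the tannakian fundamental group of the category of finite dimensional unipotent
`F`-representations of `Γ` with respect to the forgetful fibre functor `ω`: an `R`-point is a tensor
automorphism of `R ⊗ ω`, that is, a family of `R`-linear automorphisms `g A` of the `R ⊗ A` which is
natural in `A`, is the identity on the unit object and is compatible with tensor products. -/
def UnipotentCompletion (F : Type u) [Field F] (Γ : Type v) [Group Γ]
    (R : Type w) [CommRing R] [Algebra F R] :
    Subgroup (∀ A : UnipotentRep F Γ, (R ⊗[F] A.V) ≃ₗ[R] (R ⊗[F] A.V)) where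
  carrier := {g |
    (∀ (A B : UnipotentRep F Γ) (f : A.V →ₗ[F] B.V), A.IsHom B f →
      ∀ x : R ⊗[F] A.V, f.baseChange R (g A x) = g B (f.baseChange R x)) ∧
    g (UnipotentRep.unit F Γ) = 1 ∧
    (∀ A B : UnipotentRep F Γ, IsTensorAut (g A) (g B) (g (A.tensor B)))}
  mul_mem' := by
    rintro a b ⟨ha, ha', ha''⟩ ⟨hb, hb', hb''⟩
    refine ⟨?_, ?_, fun A B => (ha'' A B).mul (hb'' A B)⟩
    · intro A B f hf x
      simp only [Pi.mul_apply, LinearEquiv.mul_apply, ha A B f hf, hb A B f hf]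
    · rw [Pi.mul_apply, ha', hb', mul_one]
  one_mem' := ⟨fun _ _ _ _ _ => rfl, rfl, fun _ _ => isTensorAut_one⟩
  inv_mem' := by
    rintro a ⟨ha, ha', ha''⟩
    refine ⟨?_, ?_, fun A B => (ha'' A B).inv⟩
    · intro A B f hf x
      have h := ha A B f hf ((a A)⁻¹ x)
      rw [show a A ((a A)⁻¹ x) = x from (a A).apply_symm_apply x] at h
      rw [Pi.inv_apply, Pi.inv_apply, h]
      exact ((a B).symm_apply_apply _).symm
    · rw [Pi.inv_apply, ha', inv_one]

/-- The matrix coefficient of `g ∈ Γ^un(R)` on the representation `A` given by the vector `v` and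
the linear form `μ`: the element `μ (g v)` of `R`. -/
noncomputable def UnipotentCompletion.coeff {F : Type u} [Field F] {Γ : Type v} [Group Γ]
    {R : Type w} [CommRing R] [Algebra F R] (A : UnipotentRep F Γ) (v : A.V)
    (μ : A.V →ₗ[F] F) (g : UnipotentCompletion F Γ R) : R :=
  TensorProduct.AlgebraTensorModule.rid F R R (μ.baseChange R (g.1 A (1 ⊗ₜ[F] v)))

/-- When `R` is a topological ring, `Γ^un(R)` has the coarsest topology for which all matrix
coefficients are continuous: it is the inverse limit of the usual topologies on the `R`-points of the
unipotent algebraic groups whose inverse limit is `Γ^un`. -/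
noncomputable instance UnipotentCompletion.instTopologicalSpace (F : Type u) [Field F] (Γ : Type v)
    [Group Γ] (R : Type w) [CommRing R] [Algebra F R] [TopologicalSpace R] :
    TopologicalSpace (UnipotentCompletion F Γ R) :=
  ⨅ (A : UnipotentRep F Γ) (v : A.V) (μ : A.V →ₗ[F] F),
    TopologicalSpace.induced (UnipotentCompletion.coeff A v μ) inferInstance

/-- The automorphism of `R ⊗ V` given by the action of `γ` on a representation `V`. -/
def Representation.baseChangeAut {F : Type u} [Field F] {Γ : Type v} [Group Γ]
    {V : Type u} [AddCommGroup V] [Module F V] (ρ : Representation F Γ V)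
    (R : Type w) [CommRing R] [Algebra F R] (γ : Γ) : (R ⊗[F] V) ≃ₗ[R] (R ⊗[F] V) :=
  LinearEquiv.ofLinearMap ((ρ γ).baseChange R) ((ρ γ⁻¹).baseChange R)
    (by
      rw [← LinearMap.baseChange_comp, ← Module.End.mul_eq_comp, ← map_mul, mul_inv_cancel, map_one]
      exact LinearMap.baseChange_id)
    (by
      rw [← LinearMap.baseChange_comp, ← Module.End.mul_eq_comp, ← map_mul, inv_mul_cancel, map_one]
      exact LinearMap.baseChange_id)

/-- The natural homomorphism `Γ → Γ^un(R)`: an element of `Γ` acts on every representation. -/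
def toUnipotentCompletion (F : Type u) [Field F] (Γ : Type v) [Group Γ]
    (R : Type w) [CommRing R] [Algebra F R] : Γ →* UnipotentCompletion F Γ R where
  toFun γ := ⟨fun A => A.ρ.baseChangeAut R γ, by
    refine ⟨?_, ?_, ?_⟩
    · intro A B f hf x
      change (f.baseChange R ∘ₗ (A.ρ γ).baseChange R) x = ((B.ρ γ).baseChange R ∘ₗ f.baseChange R) x
      rw [← LinearMap.baseChange_comp, ← LinearMap.baseChange_comp, hf γ]
    · refine LinearEquiv.ext fun x => ?_
      exact LinearMap.congr_fun (LinearMap.baseChange_id (R := F) (A := R) (M := F)) x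
    · intro A B x
      induction x with
      | zero => simp
      | add x y hx hy => simp only [map_add, hx, hy]
      | tmul r y =>
        induction y with
        | zero => simp
        | add x y hx hy => simp only [TensorProduct.tmul_add, map_add, hx, hy]
        | tmul p q => rfl⟩
  map_one' := by
    refine Subtype.ext (funext fun A => LinearEquiv.ext fun x => ?_)
    change (A.ρ 1).baseChange R x = x
    rw [map_one]
    exact LinearMap.congr_fun LinearMap.baseChange_id x
  map_mul' γ δ := by
    refine Subtype.ext (funext fun A => LinearEquiv.ext fun x => ?_)
    change (A.ρ (γ * δ)).baseChange R x = ((A.ρ γ).baseChange R ∘ₗ (A.ρ δ).baseChange R) x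
    rw [map_mul, ← LinearMap.baseChange_comp]
    rfl

/-! Existence. A unipotent representation `A` kills a power of the augmentation ideal of `ℤ[Γ]`, so
for finitely generated `Γ` the image `L` of `ℤ[Γ]` in `End A` is a finitely generated abelian group.
The elements of `Γ` congruent to 1 modulo `ℓ ^ k • L` form a normal subgroup whose quotient is a
finite `ℓ`-group, because a unipotent element raised to a high power of `ℓ` is 1 modulo `ℓ ^ k`.
Matrix coefficients are therefore uniformly continuous for the pro-`ℓ` topology
(`UnipotentRep.exists_lIndex_norm_sub_lt`) and, `ℚ_[ℓ]` being complete, extend by limits to the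
pro-`ℓ` completion. Multiplicativity, naturality and tensor compatibility pass to the limit
(`proLToUnipotentCompletion`). Uniqueness is density of `Γ` plus separation of points by the matrix
coefficients.

Injectivity. It suffices that each index `N` is detected by finitely many functions `Γ → ℚ` whose
linear extension kills a power of the augmentation ideal, for these are matrix coefficients
(`IsUnipotentFunction.exists_unipotentRep`). By `ℓ`-regularity one may work in a torsion free
nilpotent quotient `G`, which is an iterated extension by `ℤ`
(`isPolyInfiniteCyclic_of_isNilpotent`). Given `τ : G → ℤ` onto and `x` with `τ x = 1`, write `g = h
* x ^ τ g` with `h` in `ker τ`. If `g ^ ℓ ^ a` always lies in `N`, integrality of `ℓ ^ (-a) * τ`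
puts the second factor in `N`; the first is handled by induction on the length of the chain.

The induction needs a unipotent function on `ker τ` to remain unipotent when composed with `g ↦ h`,
which is not a homomorphism (`IsUnipotentFunction.comp_kerProjection`). The projection is twisted by
conjugation by powers of `x`, and conjugation is trivial on the graded pieces of the filtration of
`ℚ[ker τ]` weighted by the lower central series of `G`. Nilpotence of `G` compares that filtration
with powers of the augmentation ideal. -/

/-! ### Powers of the augmentation ideal of a group algebra -/

section Augmentation

variable (k : Type*) [CommRing k] (G : Type*) [Group G]

/-- The augmentation ideal of `k[G]`, as a `k`-submodule. -/
noncomputable def augmentationSubmodule : Submodule k (MonoidAlgebra k G) :=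
  Submodule.span k (Set.range fun g : G => MonoidAlgebra.of k G g - 1)

variable {G} in
theorem of_sub_one_mem_augmentationSubmodule (g : G) :
    MonoidAlgebra.of k G g - 1 ∈ augmentationSubmodule k G :=
  Submodule.subset_span ⟨g, rfl⟩

theorem MonoidAlgebra.span_range_of : Submodule.span k (Set.range (MonoidAlgebra.of k G)) = ⊤ := by
  refine eq_top_iff.2 fun a _ => ?_
  induction a using MonoidAlgebra.induction_on with
  | of g => exact Submodule.subset_span ⟨g, rfl⟩
  | add a b ha hb => exact Submodule.add_mem _ (ha trivial) (hb trivial)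
  | smul r a ha => exact Submodule.smul_mem _ _ (ha trivial)

/-- The identity `g (h - 1) = (g h - 1) - (g - 1)` makes the linear span a left ideal; its mirror
image below makes it two-sided. -/
theorem top_mul_augmentationSubmodule :
    ⊤ * augmentationSubmodule k G = augmentationSubmodule k G := by
  refine le_antisymm ?_ (le_mul_of_one_le_left' le_top)
  rw [← MonoidAlgebra.span_range_of, augmentationSubmodule, Submodule.span_mul_span,
    Submodule.span_le]
  rintro _ ⟨_, ⟨g, rfl⟩, _, ⟨h, rfl⟩, rfl⟩
  have : MonoidAlgebra.of k G g * (MonoidAlgebra.of k G h - 1) =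
      (MonoidAlgebra.of k G (g * h) - 1) - (MonoidAlgebra.of k G g - 1) := by
    rw [map_mul]; noncomm_ring
  simp only [SetLike.mem_coe, this]
  exact Submodule.sub_mem _ (of_sub_one_mem_augmentationSubmodule k _)
    (of_sub_one_mem_augmentationSubmodule k _)

theorem augmentationSubmodule_mul_top :
    augmentationSubmodule k G * ⊤ = augmentationSubmodule k G := by
  refine le_antisymm ?_ (le_mul_of_one_le_right' le_top)
  rw [← MonoidAlgebra.span_range_of, augmentationSubmodule, Submodule.span_mul_span,
    Submodule.span_le]
  rintro _ ⟨_, ⟨g, rfl⟩, _, ⟨h, rfl⟩, rfl⟩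
  have : (MonoidAlgebra.of k G g - 1) * MonoidAlgebra.of k G h =
      (MonoidAlgebra.of k G (g * h) - 1) - (MonoidAlgebra.of k G h - 1) := by
    rw [map_mul]; noncomm_ring
  simp only [SetLike.mem_coe, this]
  exact Submodule.sub_mem _ (of_sub_one_mem_augmentationSubmodule k _)
    (of_sub_one_mem_augmentationSubmodule k _)

theorem top_mul_augmentationSubmodule_pow (n : ℕ) :
    ⊤ * augmentationSubmodule k G ^ (n + 1) = augmentationSubmodule k G ^ (n + 1) := by
  rw [pow_succ', ← mul_assoc, top_mul_augmentationSubmodule]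

theorem augmentationSubmodule_pow_mul_top (n : ℕ) :
    augmentationSubmodule k G ^ (n + 1) * ⊤ = augmentationSubmodule k G ^ (n + 1) := by
  rw [pow_succ, mul_assoc, augmentationSubmodule_mul_top]

/-- The augmentation ideal of a finitely generated group is generated by a finitely generated
`k`-submodule. -/
theorem exists_fg_le_augmentationSubmodule (hG : Group.FG G) :
    ∃ U : Submodule k (MonoidAlgebra k G), U.FG ∧ U ≤ augmentationSubmodule k G ∧
      (⊤ : Submodule k (MonoidAlgebra k G)) = 1 ⊔ ⊤ * U := by
  obtain ⟨S, hS⟩ := Group.fg_def.1 hG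
  let U : Submodule k (MonoidAlgebra k G) :=
    Submodule.span k ((fun g : G => MonoidAlgebra.of k G g - 1) '' (S : Set G))
  have key : ∀ g : G, MonoidAlgebra.of k G g - 1 ∈ ⊤ * U := by
    have hl : ∀ a b : MonoidAlgebra k G, b ∈ ⊤ * U → a * b ∈ ⊤ * U := fun a b hb => by
      have h : a * b ∈ ⊤ * (⊤ * U) := Submodule.mul_mem_mul Submodule.mem_top hb
      rw [← mul_assoc] at h
      exact mul_le_mul_left (le_top : (⊤ : Submodule k _) * ⊤ ≤ ⊤) U h
    intro g
    have hg : g ∈ Subgroup.closure (S : Set G) := hS ▸ Subgroup.mem_top g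
    induction hg using Subgroup.closure_induction with
    | mem x hx =>
      have := Submodule.mul_mem_mul (Submodule.mem_top (x := (1 : MonoidAlgebra k G)))
        (Submodule.subset_span ⟨x, hx, rfl⟩ : MonoidAlgebra.of k G x - 1 ∈ U)
      rwa [one_mul] at this
    | one => rw [map_one, sub_self]; exact Submodule.zero_mem _
    | mul x y _ _ hx hy =>
      have : MonoidAlgebra.of k G (x * y) - 1 = MonoidAlgebra.of k G x *
        (MonoidAlgebra.of k G y - 1) + (MonoidAlgebra.of k G x - 1) := by
        rw [map_mul]; noncomm_ring
      rw [this]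
      exact Submodule.add_mem _ (hl _ _ hy) hx
    | inv x _ hx =>
      have : MonoidAlgebra.of k G x⁻¹ - 1 = - (MonoidAlgebra.of k G x⁻¹ *
        (MonoidAlgebra.of k G x - 1)) := by
        rw [mul_sub, ← map_mul, inv_mul_cancel, map_one]; noncomm_ring
      rw [this]
      exact Submodule.neg_mem _ (hl _ _ hx)
  refine ⟨U, Submodule.fg_span (S.finite_toSet.image _), ?_, ?_⟩
  · exact Submodule.span_mono (Set.image_subset_range _ _)
  · refine (eq_top_iff.2 ?_).symm
    rw [← MonoidAlgebra.span_range_of, Submodule.span_le]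
    rintro _ ⟨g, rfl⟩
    have h : MonoidAlgebra.of k G g = 1 + (MonoidAlgebra.of k G g - 1) := by noncomm_ring
    rw [h, MonoidAlgebra.span_range_of]
    exact Submodule.add_mem_sup (Submodule.one_le.1 le_rfl) (key g)

/-- Multiplying `⊤ = 1 ⊔ ⊤ * U` by `U ^ m` gives `⊤ * U ^ m = U ^ m ⊔ ⊤ * U ^ (m + 1)`, so each step
costs only the finitely generated `U ^ m`. -/
theorem exists_fg_sup_augmentationSubmodule_pow (hG : Group.FG G) (n : ℕ) :
    ∃ T : Submodule k (MonoidAlgebra k G), T.FG ∧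
      T ⊔ augmentationSubmodule k G ^ (n + 1) = ⊤ := by
  obtain ⟨U, hU, hUI, hT⟩ := exists_fg_le_augmentationSubmodule k G hG
  suffices H : ∀ m : ℕ, ∃ T : Submodule k (MonoidAlgebra k G), T.FG ∧ T ⊔ ⊤ * U ^ m = ⊤ by
    obtain ⟨T, hT, h⟩ := H (n + 1)
    refine ⟨T, hT, eq_top_iff.2 (h.ge.trans (sup_le_sup_left ?_ _))⟩
    rw [← top_mul_augmentationSubmodule_pow]
    exact mul_le_mul_right (pow_le_pow_left' hUI _) _
  intro m
  induction m with
  | zero => exact ⟨⊥, Submodule.fg_bot, by simp⟩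
  | succ m ih =>
    obtain ⟨T, hTf, h⟩ := ih
    refine ⟨T ⊔ U ^ m, hTf.sup (hU.pow m), ?_⟩
    have h2 : ⊤ * U ^ m = U ^ m ⊔ ⊤ * U ^ (m + 1) := by
      nth_rewrite 1 [hT]
      rw [Submodule.sup_mul, one_mul, mul_assoc, ← pow_succ']
    rw [sup_assoc, ← h2, h]

/-- Used over `ℤ` to get a lattice in `End V`, and over `ℚ` to see that `ℚ[Γ]` modulo a power of the
augmentation ideal is finite dimensional. -/
theorem fg_range_of_augmentationSubmodule_pow_le_ker (hG : Group.FG G) {M : Type*} [AddCommGroup M]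
    [Module k M] (f : MonoidAlgebra k G →ₗ[k] M) (n : ℕ)
    (hf : augmentationSubmodule k G ^ (n + 1) ≤ LinearMap.ker f) : (LinearMap.range f).FG := by
  obtain ⟨T, hT, h⟩ := exists_fg_sup_augmentationSubmodule_pow k G hG n
  have : LinearMap.range f = T.map f := by
    rw [LinearMap.range_eq_map, ← h, Submodule.map_sup, sup_eq_left]
    rintro _ ⟨a, ha, rfl⟩
    rw [hf ha]
    exact Submodule.zero_mem _
  rw [this]
  exact hT.map f

variable {k G}

/-- A homomorphism of algebras `k[G] → End V` killing a power of the augmentation ideal gives a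
filtration of `V` on whose graded pieces `G` acts trivially. -/
theorem exists_filtration_of_augmentationSubmodule_pow_le_ker {V : Type*} [AddCommGroup V]
    [Module k V] (R : MonoidAlgebra k G →ₐ[k] Module.End k V) (n : ℕ)
    (hR : ∀ a ∈ augmentationSubmodule k G ^ (n + 1), R a = 0) :
    ∃ (I : ℕ → Submodule k V) (n : ℕ), Monotone I ∧ I 0 = ⊥ ∧ I n = ⊤ ∧
    ∀ (j : ℕ) (g : G), ∀ v ∈ I (j + 1), R (MonoidAlgebra.of k G g) v - v ∈ I j := by
  -- The `j`-th step consists of the vectors annihilated by the `j`-th power of the augmentation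
  -- ideal.
  refine ⟨fun j => ⨅ a : (augmentationSubmodule k G ^ j : Submodule _ _), LinearMap.ker (R a),
    n + 1, ?_, ?_, ?_, ?_⟩
  · refine monotone_nat_of_le_succ fun j v hv => ?_
    simp only [Submodule.mem_iInf, LinearMap.mem_ker, Subtype.forall] at hv ⊢
    intro a ha
    rw [pow_succ'] at ha
    refine Submodule.mul_induction_on ha (fun x _ y hy => ?_) fun x y hx hy => ?_
    · rw [map_mul, Module.End.mul_apply, hv y hy, map_zero]
    · rw [map_add, LinearMap.add_apply, hx, hy, add_zero]
  · refine eq_bot_iff.2 fun v hv => ?_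
    simp only [Submodule.mem_iInf, LinearMap.mem_ker, Subtype.forall] at hv
    simpa using hv 1 (by rw [pow_zero]; exact Submodule.one_le.1 le_rfl)
  · refine eq_top_iff.2 fun v _ => ?_
    simp only [Submodule.mem_iInf, LinearMap.mem_ker, Subtype.forall]
    intro a ha
    rw [hR a ha, LinearMap.zero_apply]
  · intro j g v hv
    simp only [Submodule.mem_iInf, LinearMap.mem_ker, Subtype.forall] at hv ⊢
    intro a ha
    have := hv (a * (MonoidAlgebra.of k G g - 1)) (by
      rw [pow_succ]
      exact Submodule.mul_mem_mul ha (of_sub_one_mem_augmentationSubmodule k g))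
    simpa [map_mul, map_sub] using this

/-- A unipotent representation kills a power of the augmentation ideal. -/
theorem Representation.IsUnipotent.exists_pow_eq_zero {F : Type u} [Field F] {Γ : Type v} [Group Γ]
    {V : Type u} [AddCommGroup V] [Module F V] {ρ : Representation F Γ V} (h : ρ.IsUnipotent) :
    ∃ n : ℕ, ∀ a ∈ augmentationSubmodule ℤ Γ ^ (n + 1),
      MonoidAlgebra.lift ℤ (Module.End F V) Γ ρ a = 0 := by
  obtain ⟨I, n, hI, h0, hn, hs⟩ := h
  have h1 : ∀ (j : ℕ), ∀ a ∈ augmentationSubmodule ℤ Γ, ∀ v ∈ I (j + 1),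
      MonoidAlgebra.lift ℤ (Module.End F V) Γ ρ a v ∈ I j := by
    intro j a ha v hv
    induction ha using Submodule.span_induction with
    | mem x hx =>
      obtain ⟨g, rfl⟩ := hx
      simpa using hs j g v hv
    | zero => simp
    | add x y _ _ hx hy => rw [map_add]; exact Submodule.add_mem _ hx hy
    | smul r x _ hx => rw [map_smul, LinearMap.smul_apply]; exact zsmul_mem hx r
  have h2 : ∀ (m j : ℕ), ∀ a ∈ augmentationSubmodule ℤ Γ ^ (m + 1), ∀ v ∈ I (j + (m + 1)),
      MonoidAlgebra.lift ℤ (Module.End F V) Γ ρ a v ∈ I j := by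
    intro m
    induction m with
    | zero => intro j a ha v hv; exact h1 j a (by simpa using ha) v hv
    | succ m ih =>
      intro j a ha v hv
      rw [pow_succ] at ha
      refine Submodule.mul_induction_on ha (fun x hx y hy => ?_) fun x y hx hy => ?_
      · rw [map_mul, Module.End.mul_apply]
        exact ih j x hx _ (h1 _ y hy v hv)
      · rw [map_add, LinearMap.add_apply]; exact Submodule.add_mem _ hx hy
  refine ⟨n, fun a ha => LinearMap.ext fun v => ?_⟩
  have h3 := h2 n 0 a ha v (hI (by omega : n ≤ 0 + (n + 1)) (hn ▸ Submodule.mem_top))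
  rwa [h0, Submodule.mem_bot] at h3

end Augmentation

/-! ### Unipotent matrix coefficients are continuous for the pro-`ℓ` topology -/

section Congruence

-- Modulo `ℓ`, `(1 + X) ^ ℓ ^ n` is `1 + X ^ ℓ ^ n`, and raising to the power `ℓ ^ k` improves this
-- to a congruence modulo `ℓ ^ (k + 1)`. Then `(1 + X ^ ℓ ^ n) ^ ℓ ^ k - 1` is divisible by `X ^ ℓ ^
-- n`, hence by `X ^ n`. It will be evaluated at a nilpotent `γ - 1`.
open Polynomial in
theorem Polynomial.exists_one_add_X_pow_prime_pow_sub_one (ℓ : ℕ) [Fact ℓ.Prime] (n k : ℕ) :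
    ∃ (m : ℕ) (p q : ℤ[X]), (1 + X) ^ ℓ ^ m - 1 = (ℓ : ℤ[X]) ^ k * p + X ^ n * q := by
  have hℓ : ℓ.Prime := Fact.out
  obtain ⟨r, hr⟩ := exists_add_pow_prime_pow_eq hℓ (1 : ℤ[X]) X n
  have h1 : (ℓ : ℤ[X]) ∣ (1 + X) ^ ℓ ^ n - (1 + X ^ ℓ ^ n) := by
    rw [hr]; exact ⟨1 * X * r, by ring⟩
  obtain ⟨p, hp⟩ := (pow_dvd_pow (ℓ : ℤ[X]) (Nat.le_succ k)).trans (dvd_sub_pow_of_dvd_sub h1 k)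
  have h2 : (X : ℤ[X]) ^ n ∣ (1 + X ^ ℓ ^ n) ^ ℓ ^ k - 1 := by
    have h3 := sub_dvd_pow_sub_pow (1 + X ^ ℓ ^ n : ℤ[X]) 1 (ℓ ^ k)
    rw [one_pow, add_sub_cancel_left] at h3
    exact (pow_dvd_pow X (Nat.lt_pow_self hℓ.one_lt).le).trans h3
  obtain ⟨q, hq⟩ := h2
  refine ⟨n + k, p, q, ?_⟩
  rw [← hp, ← hq, pow_add, pow_mul]
  ring

variable {Γ : Type v} [Group Γ] {E : Type*} [Ring E] (R : MonoidAlgebra ℤ Γ →ₐ[ℤ] E)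

/-- The elements of `Γ` acting trivially modulo `q` on the image of the group ring. -/
def congruenceSubgroup (q : ℕ) : Subgroup Γ where
  -- The congruence is modulo multiples of the image of `R`, not of `E`: in the application `E` is a
  -- `ℚ`-algebra, where congruences modulo `q • E` are vacuous for `q ≠ 0`.
  carrier := {γ | ∃ a, R (MonoidAlgebra.of ℤ Γ γ - 1) = q • R a}
  one_mem' := ⟨0, by rw [map_one, sub_self, map_zero, smul_zero]⟩
  mul_mem' := by
    rintro x y ⟨a, ha⟩ ⟨b, hb⟩
    refine ⟨MonoidAlgebra.of ℤ Γ x * b + a, ?_⟩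
    have : MonoidAlgebra.of ℤ Γ (x * y) - 1 = MonoidAlgebra.of ℤ Γ x *
        (MonoidAlgebra.of ℤ Γ y - 1) + (MonoidAlgebra.of ℤ Γ x - 1) := by
      rw [map_mul]; noncomm_ring
    rw [this, map_add, map_mul, ha, hb, map_add, map_mul, smul_add, mul_smul_comm]
  inv_mem' := by
    rintro x ⟨a, ha⟩
    refine ⟨- (MonoidAlgebra.of ℤ Γ x⁻¹ * a), ?_⟩
    have : MonoidAlgebra.of ℤ Γ x⁻¹ - 1 = - (MonoidAlgebra.of ℤ Γ x⁻¹ *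
        (MonoidAlgebra.of ℤ Γ x - 1)) := by
      rw [mul_sub, ← map_mul, inv_mul_cancel, map_one]; noncomm_ring
    rw [this, map_neg, map_mul, ha, map_neg, map_mul, smul_neg, mul_smul_comm]

theorem mem_congruenceSubgroup {q : ℕ} {γ : Γ} :
    γ ∈ congruenceSubgroup R q ↔ ∃ a, R (MonoidAlgebra.of ℤ Γ γ - 1) = q • R a := Iff.rfl

theorem mem_congruenceSubgroup_inv_mul {q : ℕ} {γ δ : Γ} :
    γ⁻¹ * δ ∈ congruenceSubgroup R q ↔
      ∃ a, R (MonoidAlgebra.of ℤ Γ δ) - R (MonoidAlgebra.of ℤ Γ γ) = q • R a := by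
  rw [mem_congruenceSubgroup]
  constructor
  · rintro ⟨a, ha⟩
    refine ⟨MonoidAlgebra.of ℤ Γ γ * a, ?_⟩
    rw [map_mul, ← mul_smul_comm, ← ha, ← map_mul, mul_sub, ← map_mul, mul_inv_cancel_left, mul_one,
      map_sub]
  · rintro ⟨a, ha⟩
    refine ⟨MonoidAlgebra.of ℤ Γ γ⁻¹ * a, ?_⟩
    rw [map_mul R, ← mul_smul_comm, ← ha, ← map_sub, ← map_mul R, mul_sub, ← map_mul, ← map_mul,
      inv_mul_cancel, map_one]

instance congruenceSubgroup_normal (q : ℕ) : (congruenceSubgroup R q).Normal where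
  conj_mem := by
    rintro x ⟨a, ha⟩ g
    refine ⟨MonoidAlgebra.of ℤ Γ g * a * MonoidAlgebra.of ℤ Γ g⁻¹, ?_⟩
    have : MonoidAlgebra.of ℤ Γ (g * x * g⁻¹) - 1 = MonoidAlgebra.of ℤ Γ g *
        (MonoidAlgebra.of ℤ Γ x - 1) * MonoidAlgebra.of ℤ Γ g⁻¹ := by
      rw [mul_sub, sub_mul, mul_one, ← map_mul, ← map_mul, ← map_mul, mul_inv_cancel, map_one]
    rw [this, map_mul, map_mul, ha, map_mul, map_mul, mul_smul_comm, smul_mul_assoc]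

/-- Cosets inject into `L / qL`, where `L` is the image of `R`; this is a finitely generated torsion
group, hence finite. -/
theorem finite_quotient_congruenceSubgroup (hfg : (LinearMap.range R.toLinearMap).FG) {q : ℕ}
    (hq : q ≠ 0) : Finite (Γ ⧸ congruenceSubgroup R q) := by
  let L := LinearMap.range R.toLinearMap
  let P : Submodule ℤ L := LinearMap.range (LinearMap.lsmul ℤ L (q : ℤ))
  have : Module.Finite ℤ L := Module.Finite.iff_fg.2 hfg
  have hfin : Finite (L ⧸ P) := by
    refine Module.finite_of_fg_torsion _ fun x => ?_
    obtain ⟨x, rfl⟩ := P.mkQ_surjective x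
    refine ⟨⟨(q : ℤ), mem_nonZeroDivisors_of_ne_zero (by exact_mod_cast hq)⟩, ?_⟩
    exact (Submodule.Quotient.mk_eq_zero P).2 ⟨x, rfl⟩
  let c : Γ → L ⧸ P := fun γ => P.mkQ ⟨R (MonoidAlgebra.of ℤ Γ γ), ⟨_, rfl⟩⟩
  have hc : ∀ γ δ : Γ, c γ = c δ ↔ γ⁻¹ * δ ∈ congruenceSubgroup R q := by
    intro γ δ
    rw [mem_congruenceSubgroup_inv_mul, eq_comm]
    refine (Submodule.Quotient.eq P).trans ⟨?_, ?_⟩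
    · rintro ⟨⟨_, a, rfl⟩, ha⟩
      refine ⟨a, ?_⟩
      have := congrArg Subtype.val ha
      simpa using this.symm
    · rintro ⟨a, ha⟩
      refine ⟨⟨R a, a, rfl⟩, Subtype.ext ?_⟩
      simpa using ha.symm
  refine Finite.of_injective (Quotient.lift c fun γ δ h => (hc γ δ).2 (QuotientGroup.leftRel_apply.1 h))
    fun x y => ?_
  induction x using Quotient.inductionOn
  induction y using Quotient.inductionOn
  intro h
  exact Quotient.sound (QuotientGroup.leftRel_apply.2 ((hc _ _).1 h))

theorem isPGroup_quotient_congruenceSubgroup (ℓ : ℕ) [Fact ℓ.Prime] (n : ℕ)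
    (hR : ∀ a ∈ augmentationSubmodule ℤ Γ ^ (n + 1), R a = 0) (k : ℕ) :
    IsPGroup ℓ (Γ ⧸ congruenceSubgroup R (ℓ ^ k)) := by
  obtain ⟨m, p, q, h⟩ := Polynomial.exists_one_add_X_pow_prime_pow_sub_one ℓ (n + 1) k
  intro x
  induction x using QuotientGroup.induction_on with | H γ => ?_
  refine ⟨m, ?_⟩
  rw [← QuotientGroup.mk_pow, QuotientGroup.eq_one_iff]
  have h1 := congrArg (Polynomial.aeval (MonoidAlgebra.of ℤ Γ γ - 1)) h
  simp only [map_sub, map_pow, map_add, map_mul, map_one, Polynomial.aeval_X, map_natCast,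
    add_sub_cancel] at h1
  refine ⟨Polynomial.aeval (MonoidAlgebra.of ℤ Γ γ - 1) p, ?_⟩
  rw [map_pow, h1, map_add, map_mul R ((MonoidAlgebra.of ℤ Γ γ - 1) ^ (n + 1)),
    hR _ (Submodule.pow_mem_pow _ (of_sub_one_mem_augmentationSubmodule ℤ γ) _), zero_mul, add_zero,
    map_mul, map_pow, map_natCast, nsmul_eq_mul, Nat.cast_pow]

/-- The congruence subgroups modulo powers of `ℓ`, as indices of the pro-`ℓ` completion. -/
def congruenceLIndex (ℓ : ℕ) [Fact ℓ.Prime] (hΓ : Group.FG Γ) (n : ℕ)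
    (hR : ∀ a ∈ augmentationSubmodule ℤ Γ ^ (n + 1), R a = 0) (k : ℕ) : LIndex ℓ Γ where
  N := congruenceSubgroup R (ℓ ^ k)
  normal := inferInstance
  finite := finite_quotient_congruenceSubgroup R
    (fg_range_of_augmentationSubmodule_pow_le_ker ℤ Γ hΓ R.toLinearMap n hR)
    (pow_ne_zero k (Fact.out : ℓ.Prime).ne_zero)
  isPGroup := isPGroup_quotient_congruenceSubgroup R ℓ n hR k

/-- Integers have `ℓ`-adic norm at most 1 and the norm is ultrametric, so a bound on generators
bounds the whole group. -/
theorem exists_norm_le_of_fg (ℓ : ℕ) [Fact ℓ.Prime] {M : Submodule ℤ E} (hM : M.FG) (c : E →+ ℚ) :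
    ∃ C : ℝ, 0 ≤ C ∧ ∀ x ∈ M, ‖(c x : ℚ_[ℓ])‖ ≤ C := by
  obtain ⟨S, rfl⟩ := hM
  refine ⟨∑ s ∈ S, ‖(c s : ℚ_[ℓ])‖, Finset.sum_nonneg fun _ _ => norm_nonneg _, fun x hx => ?_⟩
  induction hx using Submodule.span_induction with
  | mem x hx =>
    exact Finset.single_le_sum (f := fun s => ‖(c s : ℚ_[ℓ])‖) (fun s _ => norm_nonneg (c s : ℚ_[ℓ])) hx
  | zero =>
    rw [map_zero, Rat.cast_zero, norm_zero]
    exact Finset.sum_nonneg fun s _ => norm_nonneg (c s : ℚ_[ℓ])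
  | add x y _ _ hx hy =>
    rw [map_add, Rat.cast_add]
    exact (Padic.nonarchimedean _ _).trans (max_le hx hy)
  | smul r x _ hx =>
    rw [map_zsmul, zsmul_eq_mul, Rat.cast_mul, Rat.cast_intCast, norm_mul]
    exact (mul_le_of_le_one_left (norm_nonneg _) (Padic.norm_int_le_one r)).trans hx

/-- Within a coset of the congruence subgroup of level `ℓ ^ k`, the values differ by `ℓ ^ k` times
an element of the bounded set `c(L)`. -/
theorem exists_lIndex_norm_sub_le (ℓ : ℕ) [Fact ℓ.Prime] (hΓ : Group.FG Γ) (n : ℕ)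
    (hR : ∀ a ∈ augmentationSubmodule ℤ Γ ^ (n + 1), R a = 0) (c : E →+ ℚ) {ε : ℝ} (hε : 0 < ε) :
    ∃ i : LIndex ℓ Γ, ∀ γ δ : Γ, γ⁻¹ * δ ∈ i.N →
      ‖(c (R (MonoidAlgebra.of ℤ Γ δ)) : ℚ_[ℓ]) - (c (R (MonoidAlgebra.of ℤ Γ γ)) : ℚ_[ℓ])‖ < ε := by
  obtain ⟨C, hC0, hC⟩ := exists_norm_le_of_fg ℓ
    (fg_range_of_augmentationSubmodule_pow_le_ker ℤ Γ hΓ R.toLinearMap n hR) c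
  have hℓ : (1 : ℝ) < ℓ := by exact_mod_cast (Fact.out : ℓ.Prime).one_lt
  obtain ⟨k, hk⟩ := exists_pow_lt_of_lt_one (div_pos hε (by positivity : 0 < C + 1))
    (inv_lt_one_of_one_lt₀ hℓ)
  refine ⟨congruenceLIndex R ℓ hΓ n hR k, fun γ δ h => ?_⟩
  obtain ⟨a, ha⟩ := (mem_congruenceSubgroup_inv_mul R).1 h
  rw [← Rat.cast_sub, ← map_sub, ha, map_nsmul, nsmul_eq_mul, Rat.cast_mul, norm_mul, Nat.cast_pow,
    Rat.cast_pow, norm_pow, Rat.cast_natCast, Padic.norm_p]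
  calc _ ≤ (ℓ : ℝ)⁻¹ ^ k * C := by gcongr; exact hC _ ⟨a, rfl⟩
    _ ≤ (ℓ : ℝ)⁻¹ ^ k * (C + 1) := by gcongr; linarith
    _ < ε := by rwa [lt_div_iff₀ (by positivity)] at hk

end Congruence

theorem UnipotentRep.exists_lIndex_norm_sub_lt {Γ : Type v} [Group Γ] (ℓ : ℕ) [Fact ℓ.Prime]
    (hΓ : Group.FG Γ) (A : UnipotentRep ℚ Γ) (w : A.V) (μ : A.V →ₗ[ℚ] ℚ) {ε : ℝ} (hε : 0 < ε) :
    ∃ i : LIndex ℓ Γ, ∀ γ δ : Γ, γ⁻¹ * δ ∈ i.N →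
      ‖(μ (A.ρ δ w) : ℚ_[ℓ]) - (μ (A.ρ γ w) : ℚ_[ℓ])‖ < ε := by
  obtain ⟨n, hn⟩ := A.isUnipotent.exists_pow_eq_zero
  have := exists_lIndex_norm_sub_le (MonoidAlgebra.lift ℤ (Module.End ℚ A.V) Γ A.ρ) ℓ hΓ n hn
    (μ ∘ₗ LinearMap.applyₗ w).toAddMonoidHom hε
  simpa using this

/-! ### The topology of the pro-`ℓ` completion -/

section ProL

open Filter Topology

variable {ℓ : ℕ} {Γ : Type v} [Group Γ]

instance LIndex.instNonempty : Nonempty (LIndex ℓ Γ) :=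
  ⟨⟨⊤, inferInstance, inferInstance, fun x => ⟨0, by
    have := QuotientGroup.subsingleton_quotient_top (G := Γ)
    exact Subsingleton.elim _ _⟩⟩⟩

/-- The intersection of two normal subgroups with finite `ℓ`-group quotients. -/
def LIndex.inf (i j : LIndex ℓ Γ) : LIndex ℓ Γ where
  N := i.N ⊓ j.N
  normal := inferInstance
  finite := by
    have := i.finite
    have := j.finite
    have hi : i.N.FiniteIndex := Subgroup.finiteIndex_of_finite_quotient
    have hj : j.N.FiniteIndex := Subgroup.finiteIndex_of_finite_quotient
    exact Subgroup.finite_quotient_of_finiteIndex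
  isPGroup := by
    intro x
    induction x using QuotientGroup.induction_on with | H γ => ?_
    obtain ⟨a, ha⟩ := i.isPGroup (γ : Γ ⧸ i.N)
    obtain ⟨b, hb⟩ := j.isPGroup (γ : Γ ⧸ j.N)
    rw [← QuotientGroup.mk_pow, QuotientGroup.eq_one_iff] at ha hb
    refine ⟨a + b, ?_⟩
    rw [← QuotientGroup.mk_pow, QuotientGroup.eq_one_iff]
    refine ⟨?_, ?_⟩
    · rw [pow_add, pow_mul]; exact pow_mem ha _
    · rw [pow_add, mul_comm, pow_mul]; exact pow_mem hb _

theorem ProLCompletion.nhds_eq (x : ProLCompletion ℓ Γ) :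
    𝓝 x = ⨅ i : LIndex ℓ Γ, 𝓟 {y | y.1 i = x.1 i} := by
  rw [nhds_iInf]
  refine iInf_congr fun i => ?_
  let _ : TopologicalSpace (Γ ⧸ i.N) := ⊥
  have : DiscreteTopology (Γ ⧸ i.N) := ⟨rfl⟩
  rw [nhds_induced, nhds_discrete, comap_pure]
  rfl

theorem ProLCompletion.eq_of_le {x y : ProLCompletion ℓ Γ} {i j : LIndex ℓ Γ} (h : i.N ≤ j.N)
    (hxy : y.1 i = x.1 i) : y.1 j = x.1 j := by
  rw [← x.2 i j h, ← y.2 i j h, hxy]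

theorem ProLCompletion.nhds_hasBasis (x : ProLCompletion ℓ Γ) :
    (𝓝 x).HasBasis (fun _ : LIndex ℓ Γ => True) fun i => {y | y.1 i = x.1 i} := by
  rw [ProLCompletion.nhds_eq]
  refine hasBasis_iInf_principal fun i j => ⟨i.inf j, ?_, ?_⟩
  · exact fun y hy => ProLCompletion.eq_of_le (inf_le_left : i.N ⊓ j.N ≤ i.N) hy
  · exact fun y hy => ProLCompletion.eq_of_le (inf_le_right : i.N ⊓ j.N ≤ j.N) hy

theorem denseRange_toProLCompletion : DenseRange (toProLCompletion ℓ Γ) := by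
  intro x
  rw [mem_closure_iff_nhds_basis (ProLCompletion.nhds_hasBasis x)]
  intro i _
  obtain ⟨γ, hγ⟩ := QuotientGroup.mk_surjective (x.1 i)
  exact ⟨_, ⟨γ, rfl⟩, hγ⟩

/-- The filter of neighbourhoods in `Γ` of an element of the pro-`ℓ` completion. -/
def proLFilter (x : ProLCompletion ℓ Γ) : Filter Γ := comap (toProLCompletion ℓ Γ) (𝓝 x)

instance proLFilter_neBot (x : ProLCompletion ℓ Γ) : (proLFilter x).NeBot :=
  comap_neBot fun t ht => by
    obtain ⟨_, h, γ, rfl⟩ := mem_closure_iff_nhds.1 (denseRange_toProLCompletion x) t ht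
    exact ⟨γ, h⟩

theorem proLFilter_hasBasis (x : ProLCompletion ℓ Γ) :
    (proLFilter x).HasBasis (fun _ : LIndex ℓ Γ => True) fun i => {γ | (γ : Γ ⧸ i.N) = x.1 i} :=
  (ProLCompletion.nhds_hasBasis x).comap _

theorem tendsto_mul_proLFilter (x y : ProLCompletion ℓ Γ) :
    Tendsto (fun p : Γ × Γ => p.1 * p.2) (proLFilter x ×ˢ proLFilter y) (proLFilter (x * y)) := by
  rw [((proLFilter_hasBasis x).prod (proLFilter_hasBasis y)).tendsto_iff
    (proLFilter_hasBasis (x * y))]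
  rintro i -
  refine ⟨(i, i), ⟨trivial, trivial⟩, ?_⟩
  rintro ⟨γ, δ⟩ ⟨hγ, hδ⟩
  simp only [Set.mem_ofPred_eq] at hγ hδ ⊢
  rw [QuotientGroup.mk_mul, hγ, hδ]
  rfl

theorem pure_le_proLFilter (γ : Γ) : pure γ ≤ proLFilter (toProLCompletion ℓ Γ γ) := by
  rw [proLFilter, ← map_le_iff_le_comap, map_pure]
  exact pure_le_nhds _

/-- Completeness of `ℚ_[ℓ]`: two elements of `Γ` near `x` lie in the same coset of `i.N`, so the
image filter is Cauchy. -/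
theorem cauchy_map_proLFilter [Fact ℓ.Prime] {f : Γ → ℚ_[ℓ]}
    (hf : ∀ ε > 0, ∃ i : LIndex ℓ Γ, ∀ γ δ : Γ, γ⁻¹ * δ ∈ i.N → ‖f δ - f γ‖ < ε)
    (x : ProLCompletion ℓ Γ) : ∃ c, Tendsto f (proLFilter x) (𝓝 c) := by
  rw [← cauchy_map_iff_exists_tendsto, Metric.cauchy_iff]
  refine ⟨inferInstance, fun ε hε => ?_⟩
  obtain ⟨i, hi⟩ := hf ε hε
  refine ⟨_, image_mem_map ((proLFilter_hasBasis x).mem_of_mem (i := i) trivial), ?_⟩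
  rintro _ ⟨γ, hγ, rfl⟩ _ ⟨δ, hδ, rfl⟩
  rw [dist_eq_norm]
  refine hi _ _ (QuotientGroup.eq.1 ?_)
  rw [hδ, hγ]

theorem ProLCompletion.continuous_of_tendsto {Y : Type*} [TopologicalSpace Y] [T3Space Y]
    (f : Γ → Y) (c : ProLCompletion ℓ Γ → Y) (h : ∀ x, Tendsto f (proLFilter x) (𝓝 (c x))) :
    Continuous c := by
  -- With the induced topology the map from `Γ` is dense inducing even when it is not injective, and
  -- regularity of `Y` makes the extension by limits continuous.
  let _ : TopologicalSpace Γ := TopologicalSpace.induced (toProLCompletion ℓ Γ) inferInstance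
  have di : IsDenseInducing (toProLCompletion ℓ Γ) := ⟨⟨rfl⟩, denseRange_toProLCompletion⟩
  have : c = di.extend f := funext fun x => (di.extend_eq_of_tendsto (h x)).symm
  rw [this]
  exact di.continuous_extend fun x => ⟨c x, h x⟩

end ProL
-- Matrix coefficients determine the points and the topology of the unipotent completion.
section Coefficients

open Module

variable {F : Type u} [Field F] {Γ : Type v} [Group Γ] {R : Type w} [CommRing R] [Algebra F R]

theorem Module.Basis.baseChange_repr_eq {V ι : Type*} [AddCommGroup V] [Module F V] (b : Basis ι F V)
    (y : R ⊗[F] V) (i : ι) : (b.baseChange R).repr y i =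
      TensorProduct.AlgebraTensorModule.rid F R R ((b.coord i).baseChange R y) := by
  induction y with
  | zero => simp
  | add x y hx hy => simp [hx, hy]
  | tmul r x => simp [Basis.baseChange_repr_tmul]

theorem UnipotentCompletion.ext_coeff {g h : UnipotentCompletion F Γ R}
    (H : ∀ A w μ, UnipotentCompletion.coeff A w μ g = UnipotentCompletion.coeff A w μ h) : g = h := by
  refine Subtype.ext (funext fun A => ?_)
  let b := finBasis F A.V
  refine (b.baseChange R).ext' fun j => ?_
  refine (b.baseChange R).ext_elem fun i => ?_
  rw [Basis.baseChange_repr_eq, Basis.baseChange_repr_eq, Basis.baseChange_apply]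
  exact H A (b j) (b.coord i)

theorem UnipotentCompletion.continuous_coeff [TopologicalSpace R] (A : UnipotentRep F Γ) (w : A.V)
    (μ : A.V →ₗ[F] F) : Continuous (UnipotentCompletion.coeff (R := R) A w μ) :=
  continuous_iInf_dom (continuous_iInf_dom (continuous_iInf_dom continuous_induced_dom))

theorem UnipotentCompletion.continuous_iff [TopologicalSpace R] {X : Type*} [TopologicalSpace X]
    {f : X → UnipotentCompletion F Γ R} :
    Continuous f ↔ ∀ A w μ, Continuous fun x => UnipotentCompletion.coeff A w μ (f x) := by
  refine ⟨fun h A w μ => (UnipotentCompletion.continuous_coeff A w μ).comp h, fun h => ?_⟩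
  exact continuous_iInf_rng.2 fun A => continuous_iInf_rng.2 fun w => continuous_iInf_rng.2 fun μ =>
    continuous_induced_rng.2 (h A w μ)

theorem UnipotentCompletion.coeff_toUnipotentCompletion (A : UnipotentRep F Γ) (w : A.V)
    (μ : A.V →ₗ[F] F) (γ : Γ) :
    UnipotentCompletion.coeff A w μ (toUnipotentCompletion F Γ R γ) =
      algebraMap F R (μ (A.ρ γ w)) := by
  change TensorProduct.AlgebraTensorModule.rid F R R
    (μ.baseChange R ((A.ρ γ).baseChange R (1 ⊗ₜ[F] w))) = _
  simp [Algebra.algebraMap_eq_smul_one]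

theorem UnipotentCompletion.eq_of_continuous [TopologicalSpace R] [T2Space R] {ℓ : ℕ}
    {φ ψ : ProLCompletion ℓ Γ → UnipotentCompletion F Γ R} (hφ : Continuous φ)
    (hψ : Continuous ψ) (h : ∀ γ, φ (toProLCompletion ℓ Γ γ) = ψ (toProLCompletion ℓ Γ γ)) :
    φ = ψ := by
  refine funext fun x => UnipotentCompletion.ext_coeff fun A w μ => ?_
  refine congrFun (denseRange_toProLCompletion.equalizer (UnipotentCompletion.continuous_iff.1 hφ A w μ)
    (UnipotentCompletion.continuous_iff.1 hψ A w μ) (funext fun γ => ?_)) x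
  simp only [Function.comp_apply, h]

end Coefficients

/-! ### The action of the pro-`ℓ` completion on unipotent representations -/

section Extension

open Filter Topology Module

/-- The module topology on an endomorphism ring. -/
@[reducible]
def endTopology (K W : Type*) [CommRing K] [TopologicalSpace K] [AddCommGroup W] [Module K W] :
    TopologicalSpace (End K W) := moduleTopology K (End K W)

attribute [local instance] endTopology

instance endTopology_isModuleTopology (K W : Type*) [CommRing K] [TopologicalSpace K]
    [AddCommGroup W] [Module K W] : IsModuleTopology K (End K W) := ⟨rfl⟩

/-- Provides uniqueness of limits of endomorphisms. The module topology makes the linear and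
bilinear maps used below continuous, so algebraic identities valid on `Γ` pass to limits. -/
theorem endTopology_t2Space (K W : Type*) [Field K] [TopologicalSpace K] [IsTopologicalRing K]
    [T2Space K] [AddCommGroup W] [Module K W] [FiniteDimensional K W] : T2Space (End K W) := by
  let b := finBasis K W
  let e := LinearMap.toMatrix b b
  have : IsModuleTopology K (Matrix (Fin (finrank K W)) (Fin (finrank K W)) K) :=
    inferInstanceAs (IsModuleTopology K (Fin (finrank K W) → Fin (finrank K W) → K))
  exact T2Space.of_injective_continuous e.injective
    (IsModuleTopology.continuous_of_linearMap e.toLinearMap)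

theorem continuous_end_mul (K W : Type*) [Field K] [TopologicalSpace K] [IsTopologicalRing K]
    [AddCommGroup W] [Module K W] [FiniteDimensional K W] :
    Continuous fun p : End K W × End K W => p.1 * p.2 :=
  IsModuleTopology.continuous_bilinear_of_finite_left (LinearMap.mul K (End K W))

theorem continuous_end_tensorProductMap (K W W' : Type*) [Field K] [TopologicalSpace K]
    [IsTopologicalRing K] [AddCommGroup W] [Module K W] [FiniteDimensional K W] [AddCommGroup W']
    [Module K W'] :
    Continuous fun p : End K W × End K W' => (TensorProduct.map p.1 p.2 : End K (W ⊗[K] W')) := by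
  have := IsModuleTopology.toContinuousAdd K (End K (W ⊗[K] W'))
  exact IsModuleTopology.continuous_bilinear_of_finite_left (A := End K W) (B := End K W')
    (C := End K (W ⊗[K] W')) (TensorProduct.mapBilinear (RingHom.id K) W W' W W')

variable {ℓ : ℕ} [Fact ℓ.Prime] {Γ : Type v} [Group Γ]

/-- Each matrix entry in a rational basis converges, and the linear map from matrices to
endomorphisms is continuous. -/
theorem exists_tendsto_baseChange (hΓ : Group.FG Γ) (A : UnipotentRep ℚ Γ)
    (x : ProLCompletion ℓ Γ) : ∃ T : End ℚ_[ℓ] (ℚ_[ℓ] ⊗[ℚ] A.V),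
      Tendsto (fun γ => (A.ρ γ).baseChange ℚ_[ℓ]) (proLFilter x) (𝓝 T) := by
  let b := finBasis ℚ A.V
  let B := b.baseChange ℚ_[ℓ]
  have h : ∀ i j, ∃ c, Tendsto (fun γ => ((b.coord i (A.ρ γ (b j)) : ℚ) : ℚ_[ℓ]))
      (proLFilter x) (𝓝 c) := fun i j =>
    cauchy_map_proLFilter (fun ε hε => A.exists_lIndex_norm_sub_lt ℓ hΓ (b j) (b.coord i) hε) x
  choose m hm using h
  have : IsModuleTopology ℚ_[ℓ] (Matrix (Fin (finrank ℚ A.V)) (Fin (finrank ℚ A.V)) ℚ_[ℓ]) :=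
    inferInstanceAs (IsModuleTopology ℚ_[ℓ] (Fin (finrank ℚ A.V) → Fin (finrank ℚ A.V) → ℚ_[ℓ]))
  have := IsModuleTopology.toContinuousAdd ℚ_[ℓ] (End ℚ_[ℓ] (ℚ_[ℓ] ⊗[ℚ] A.V))
  have hc : Continuous (Matrix.toLin B B) :=
    IsModuleTopology.continuous_of_linearMap (Matrix.toLin B B).toLinearMap
  have hm' : Tendsto (fun γ => LinearMap.toMatrix B B ((A.ρ γ).baseChange ℚ_[ℓ])) (proLFilter x)
      (𝓝 (Matrix.of m)) := by
    refine tendsto_pi_nhds.2 fun i => tendsto_pi_nhds.2 fun j => ?_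
    refine (hm i j).congr fun γ => ?_
    rw [LinearMap.toMatrix_apply, Basis.baseChange_apply, LinearMap.baseChange_tmul,
      Basis.baseChange_repr_tmul]
    simp [Algebra.smul_def]
  refine ⟨Matrix.toLin B B (Matrix.of m), ((hc.tendsto _).comp hm').congr fun γ => ?_⟩
  simp

/-- The action of an element of the pro-`ℓ` completion on the `ℓ`-adic points of a unipotent
representation. -/
noncomputable def proLAction (hΓ : Group.FG Γ) (x : ProLCompletion ℓ Γ) (A : UnipotentRep ℚ Γ) :
    End ℚ_[ℓ] (ℚ_[ℓ] ⊗[ℚ] A.V) := (exists_tendsto_baseChange hΓ A x).choose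

theorem tendsto_proLAction (hΓ : Group.FG Γ) (x : ProLCompletion ℓ Γ) (A : UnipotentRep ℚ Γ) :
    Tendsto (fun γ => (A.ρ γ).baseChange ℚ_[ℓ]) (proLFilter x) (𝓝 (proLAction hΓ x A)) :=
  (exists_tendsto_baseChange hΓ A x).choose_spec

theorem tendsto_proLAction_apply (hΓ : Group.FG Γ) (x : ProLCompletion ℓ Γ) (A : UnipotentRep ℚ Γ)
    {M : Type*} [AddCommGroup M] [Module ℚ_[ℓ] M] [TopologicalSpace M] [IsModuleTopology ℚ_[ℓ] M]
    (f : End ℚ_[ℓ] (ℚ_[ℓ] ⊗[ℚ] A.V) →ₗ[ℚ_[ℓ]] M) :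
    Tendsto (fun γ => f ((A.ρ γ).baseChange ℚ_[ℓ])) (proLFilter x) (𝓝 (f (proLAction hΓ x A))) := by
  have := IsModuleTopology.toContinuousAdd ℚ_[ℓ] M
  exact ((IsModuleTopology.continuous_of_linearMap f).tendsto _).comp (tendsto_proLAction hΓ x A)

theorem proLAction_toProLCompletion (hΓ : Group.FG Γ) (γ : Γ) (A : UnipotentRep ℚ Γ) :
    proLAction hΓ (toProLCompletion ℓ Γ γ) A = (A.ρ γ).baseChange ℚ_[ℓ] := by
  have := endTopology_t2Space ℚ_[ℓ] (ℚ_[ℓ] ⊗[ℚ] A.V)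
  have h1 := (tendsto_proLAction hΓ (toProLCompletion ℓ Γ γ) A).mono_left (pure_le_proLFilter γ)
  exact tendsto_nhds_unique h1 (tendsto_pure_nhds _ _)

theorem proLAction_one (hΓ : Group.FG Γ) (A : UnipotentRep ℚ Γ) :
    proLAction hΓ (1 : ProLCompletion ℓ Γ) A = 1 := by
  rw [← map_one (toProLCompletion ℓ Γ), proLAction_toProLCompletion, map_one]
  exact LinearMap.baseChange_id

theorem proLAction_mul (hΓ : Group.FG Γ) (x y : ProLCompletion ℓ Γ) (A : UnipotentRep ℚ Γ) :
    proLAction hΓ (x * y) A = proLAction hΓ x A * proLAction hΓ y A := by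
  have := endTopology_t2Space ℚ_[ℓ] (ℚ_[ℓ] ⊗[ℚ] A.V)
  have h1 := (tendsto_proLAction hΓ (x * y) A).comp (tendsto_mul_proLFilter x y)
  have h2 := ((continuous_end_mul ℚ_[ℓ] (ℚ_[ℓ] ⊗[ℚ] A.V)).tendsto _).comp
    (((tendsto_proLAction hΓ x A).comp tendsto_fst).prodMk_nhds
      ((tendsto_proLAction hΓ y A).comp tendsto_snd))
  refine tendsto_nhds_unique (h1.congr fun p => ?_) h2
  simp only [Function.comp_apply, map_mul]
  exact LinearMap.baseChange_comp _ _

theorem proLAction_natural (hΓ : Group.FG Γ) (x : ProLCompletion ℓ Γ) {A B : UnipotentRep ℚ Γ}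
    (f : A.V →ₗ[ℚ] B.V) (hf : A.IsHom B f) (y : ℚ_[ℓ] ⊗[ℚ] A.V) :
    f.baseChange ℚ_[ℓ] (proLAction hΓ x A y) = proLAction hΓ x B (f.baseChange ℚ_[ℓ] y) := by
  let b := finBasis ℚ_[ℓ] (ℚ_[ℓ] ⊗[ℚ] B.V)
  -- Comparing coordinates turns both sides into linear functionals of the limiting endomorphisms,
  -- so only scalar limits have to be compared.
  refine b.ext_elem fun i => ?_
  have h1 := tendsto_proLAction_apply hΓ x A
    (b.coord i ∘ₗ f.baseChange ℚ_[ℓ] ∘ₗ LinearMap.applyₗ y)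
  have h2 := tendsto_proLAction_apply hΓ x B
    (b.coord i ∘ₗ LinearMap.applyₗ (f.baseChange ℚ_[ℓ] y))
  refine tendsto_nhds_unique (h1.congr fun γ => ?_) h2
  change b.coord i ((f.baseChange ℚ_[ℓ] ∘ₗ (A.ρ γ).baseChange ℚ_[ℓ]) y) =
    b.coord i (((B.ρ γ).baseChange ℚ_[ℓ] ∘ₗ f.baseChange ℚ_[ℓ]) y)
  rw [← LinearMap.baseChange_comp, ← LinearMap.baseChange_comp, hf γ]

theorem proLAction_unit (hΓ : Group.FG Γ) (x : ProLCompletion ℓ Γ) :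
    proLAction hΓ x (UnipotentRep.unit ℚ Γ) = 1 := by
  have := endTopology_t2Space ℚ_[ℓ] (ℚ_[ℓ] ⊗[ℚ] (UnipotentRep.unit ℚ Γ).V)
  refine tendsto_nhds_unique (tendsto_proLAction hΓ x _) ?_
  refine tendsto_const_nhds.congr fun γ => ?_
  exact (LinearMap.baseChange_id (R := ℚ) (A := ℚ_[ℓ]) (M := ℚ)).symm

theorem proLAction_tensor (hΓ : Group.FG Γ) (x : ProLCompletion ℓ Γ) (A B : UnipotentRep ℚ Γ) :
    (TensorProduct.AlgebraTensorModule.distribBaseChange ℚ ℚ_[ℓ] A.V B.V).conj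
      (proLAction hΓ x (A.tensor B)) =
      TensorProduct.map (proLAction hΓ x A) (proLAction hΓ x B) := by
  have := endTopology_t2Space ℚ_[ℓ] ((ℚ_[ℓ] ⊗[ℚ] A.V) ⊗[ℚ_[ℓ]] (ℚ_[ℓ] ⊗[ℚ] B.V))
  have h1 := tendsto_proLAction_apply hΓ x (A.tensor B)
    (M := End ℚ_[ℓ] ((ℚ_[ℓ] ⊗[ℚ] A.V) ⊗[ℚ_[ℓ]] (ℚ_[ℓ] ⊗[ℚ] B.V)))
    (TensorProduct.AlgebraTensorModule.distribBaseChange ℚ ℚ_[ℓ] A.V B.V).conj.toLinearMap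
  have hc := continuous_end_tensorProductMap ℚ_[ℓ] (ℚ_[ℓ] ⊗[ℚ] A.V) (ℚ_[ℓ] ⊗[ℚ] B.V)
  have h2 := (hc.tendsto _).comp
    ((tendsto_proLAction hΓ x A).prodMk_nhds (tendsto_proLAction hΓ x B))
  refine tendsto_nhds_unique h1 (h2.congr fun γ => ?_)
  refine LinearMap.ext fun y => ?_
  obtain ⟨z, rfl⟩ := (TensorProduct.AlgebraTensorModule.distribBaseChange ℚ ℚ_[ℓ] A.V B.V).surjective y
  have h3 := ((toUnipotentCompletion ℚ Γ ℚ_[ℓ] γ).2.2.2 A B z).symm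
  refine Eq.trans h3 ?_
  simp only [LinearEquiv.coe_coe, LinearEquiv.conj_apply_apply, LinearEquiv.symm_apply_apply]
  rfl

/-- The extension of `Γ → Γ^un(ℚ_ℓ)` to the pro-`ℓ` completion. -/
noncomputable def proLToUnipotentCompletion (ℓ : ℕ) [Fact ℓ.Prime] (hΓ : Group.FG Γ) :
    ProLCompletion ℓ Γ →* UnipotentCompletion ℚ Γ ℚ_[ℓ] where
  toFun x := ⟨fun A => LinearEquiv.ofLinearMap (proLAction hΓ x A) (proLAction hΓ x⁻¹ A)
      (by
        change proLAction hΓ x A * proLAction hΓ x⁻¹ A = 1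
        rw [← proLAction_mul, mul_inv_cancel, proLAction_one])
      (by
        change proLAction hΓ x⁻¹ A * proLAction hΓ x A = 1
        rw [← proLAction_mul, inv_mul_cancel, proLAction_one]), by
    refine ⟨?_, ?_, ?_⟩
    · exact fun A B f hf y => proLAction_natural hΓ x f hf y
    · exact LinearEquiv.ext fun y => LinearMap.congr_fun (proLAction_unit hΓ x) y
    · intro A B y
      have h := LinearMap.congr_fun (proLAction_tensor hΓ x A B)
        (TensorProduct.AlgebraTensorModule.distribBaseChange ℚ ℚ_[ℓ] A.V B.V y)
      rw [LinearEquiv.conj_apply_apply, LinearEquiv.symm_apply_apply] at h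
      exact h⟩
  map_one' := Subtype.ext (funext fun A => LinearEquiv.ext fun y =>
    LinearMap.congr_fun (proLAction_one hΓ A) y)
  map_mul' x y := Subtype.ext (funext fun A => LinearEquiv.ext fun z =>
    LinearMap.congr_fun (proLAction_mul hΓ x y A) z)

theorem proLToUnipotentCompletion_toProLCompletion (hΓ : Group.FG Γ) (γ : Γ) :
    proLToUnipotentCompletion ℓ hΓ (toProLCompletion ℓ Γ γ) = toUnipotentCompletion ℚ Γ ℚ_[ℓ] γ :=
  Subtype.ext (funext fun A => LinearEquiv.ext fun z =>
    LinearMap.congr_fun (proLAction_toProLCompletion hΓ γ A) z)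

theorem tendsto_coeff_proLToUnipotentCompletion (hΓ : Group.FG Γ) (x : ProLCompletion ℓ Γ)
    (A : UnipotentRep ℚ Γ) (w : A.V) (μ : A.V →ₗ[ℚ] ℚ) :
    Tendsto (fun γ => (μ (A.ρ γ w) : ℚ_[ℓ])) (proLFilter x)
      (𝓝 (UnipotentCompletion.coeff A w μ (proLToUnipotentCompletion ℓ hΓ x))) := by
  have h := tendsto_proLAction_apply hΓ x A
    ((TensorProduct.AlgebraTensorModule.rid ℚ ℚ_[ℓ] ℚ_[ℓ]).toLinearMap ∘ₗ μ.baseChange ℚ_[ℓ] ∘ₗ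
      LinearMap.applyₗ (1 ⊗ₜ[ℚ] w))
  refine h.congr fun γ => ?_
  exact UnipotentCompletion.coeff_toUnipotentCompletion (R := ℚ_[ℓ]) A w μ γ

theorem continuous_proLToUnipotentCompletion (hΓ : Group.FG Γ) :
    Continuous (proLToUnipotentCompletion (Γ := Γ) ℓ hΓ) :=
  UnipotentCompletion.continuous_iff.2 fun A w μ =>
    ProLCompletion.continuous_of_tendsto _ _ fun x =>
      tendsto_coeff_proLToUnipotentCompletion hΓ x A w μ

end Extension

/-! ### Finitely generated torsion free nilpotent groups are poly-infinite-cyclic -/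

section Nilpotent

open scoped commutatorElement

/-- Groups obtained from the trivial group by iterated extensions by `ℤ`. -/
inductive IsPolyInfiniteCyclic : (G : Type v) → [Group G] → Prop
  | of_subsingleton (G : Type v) [Group G] [Subsingleton G] : IsPolyInfiniteCyclic G
  | of_ker (G : Type v) [Group G] (τ : G →* Multiplicative ℤ) (hτ : Function.Surjective τ)
      (h : IsPolyInfiniteCyclic τ.ker) : IsPolyInfiniteCyclic G

theorem IsPolyInfiniteCyclic.of_mulEquiv {G : Type v} [Group G] (h : IsPolyInfiniteCyclic G)
    {G' : Type w} [Group G'] (e : G ≃* G') : IsPolyInfiniteCyclic G' := by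
  induction h generalizing G' with
  | of_subsingleton G =>
    have := e.symm.injective.subsingleton
    exact .of_subsingleton G'
  | of_ker G τ hτ _ ih =>
    refine .of_ker G' (τ.comp e.symm.toMonoidHom) (hτ.comp e.symm.surjective) (ih ?_)
    refine (e.subgroupMap τ.ker).trans (MulEquiv.subgroupCongr ?_)
    ext x
    exact Subgroup.mem_map_equiv (f := e) (K := τ.ker)

/-- The chain of `Q` is pulled back along `π`: the preimage of `ker τ` is an extension of `ker τ` by
`ker π`, so the induction runs on `Q`. -/
theorem IsPolyInfiniteCyclic.of_surjective {Q : Type v} [Group Q] (hQ : IsPolyInfiniteCyclic Q)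
    {G : Type v} [Group G] (π : G →* Q) (hπ : Function.Surjective π)
    (hK : IsPolyInfiniteCyclic π.ker) : IsPolyInfiniteCyclic G := by
  induction hQ generalizing G with
  | of_subsingleton Q =>
    refine hK.of_mulEquiv ((MulEquiv.subgroupCongr ?_).trans Subgroup.topEquiv)
    exact eq_top_iff.2 fun x _ => Subsingleton.elim _ _
  | of_ker Q τ hτ _ ih =>
    let H := (τ.comp π).ker
    let π' : H →* τ.ker := (π.comp H.subtype).codRestrict τ.ker fun x => x.2
    have hker : π'.ker = π.ker.subgroupOf H := by
      ext x
      rw [Subgroup.mem_subgroupOf, MonoidHom.mem_ker, MonoidHom.mem_ker]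
      exact Subtype.ext_iff
    have hle : π.ker ≤ H := fun x hx => by
      rw [MonoidHom.mem_ker] at hx ⊢
      rw [MonoidHom.comp_apply, hx, map_one]
    refine .of_ker G (τ.comp π) (hτ.comp hπ) (ih π' ?_ ?_)
    · rintro ⟨q, hq⟩
      obtain ⟨g, rfl⟩ := hπ q
      exact ⟨⟨g, hq⟩, rfl⟩
    · exact hK.of_mulEquiv ((Subgroup.subgroupOfEquivOfLe hle).symm.trans
        (MulEquiv.subgroupCongr hker.symm))

theorem isPolyInfiniteCyclic_multiplicative_fin (r : ℕ) :
    IsPolyInfiniteCyclic (Multiplicative (Fin r → ℤ)) := by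
  induction r with
  | zero => exact .of_subsingleton _
  | succ r ih =>
    let τ : Multiplicative (Fin (r + 1) → ℤ) →* Multiplicative ℤ :=
      (Pi.evalAddMonoidHom (fun _ => ℤ) 0).toMultiplicative
    let j : Multiplicative (Fin r → ℤ) →* Multiplicative (Fin (r + 1) → ℤ) :=
      AddMonoidHom.toMultiplicative
        { toFun := fun x => Fin.cons 0 x
          map_zero' := by ext i; cases i using Fin.cases <;> simp
          map_add' := fun x y => by ext i; cases i using Fin.cases <;> simp }
    refine .of_ker _ τ (fun n => ⟨Multiplicative.ofAdd fun _ => n.toAdd, rfl⟩) (ih.of_mulEquiv ?_)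
    refine MulEquiv.ofBijective (j.codRestrict τ.ker fun x => rfl) ⟨fun x y h => ?_, ?_⟩
    · have h1 := congrArg (fun z => Fin.tail (Multiplicative.toAdd z.1)) h
      exact h1
    · rintro ⟨x, hx⟩
      refine ⟨Multiplicative.ofAdd (Fin.tail x.toAdd), Subtype.ext ?_⟩
      have hx0 : x.toAdd 0 = 0 := hx
      have := Fin.cons_self_tail x.toAdd
      rw [hx0] at this
      exact this

theorem isPolyInfiniteCyclic_of_commGroup {Z : Type v} [CommGroup Z] (hfg : Group.FG Z)
    (htf : ∀ x : Z, IsOfFinOrder x → x = 1) : IsPolyInfiniteCyclic Z := by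
  have : Module.Finite ℤ (Additive Z) :=
    Module.Finite.iff_addGroup_fg.2 (AddGroup.fg_iff_mul_fg.2 (show Group.FG Z from hfg))
  have : IsMulTorsionFree Z := isMulTorsionFree_iff_not_isOfFinOrder.2 fun x hx h => hx (htf x h)
  let b := Module.finBasis ℤ (Additive Z)
  exact (isPolyInfiniteCyclic_multiplicative_fin _).of_mulEquiv
    (AddEquiv.toMultiplicative b.equivFun.symm.toAddEquiv |>.trans
      (MulEquiv.toMultiplicative_toAdditive))

/-- In a torsion free nilpotent group, an element with a central power is central. -/
theorem mem_center_of_pow_mem_center {G : Type*} [Group G] [Group.IsNilpotent G]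
    (htf : ∀ x : G, IsOfFinOrder x → x = 1) {x : G} {n : ℕ} (hn : 0 < n)
    (hx : x ^ n ∈ Subgroup.center G) : x ∈ Subgroup.center G := by
  -- For `y` in the next term of the series, `c = [x, y]` lies one term lower and so commutes with
  -- `x`. Hence `[x ^ n, y] = c ^ n`; this is 1 because `x ^ n` is central, and torsion freeness
  -- gives `c = 1`.
  have key : ∀ (i : ℕ), ∀ y ∈ Subgroup.upperCentralSeries G i, Commute x y := by
    intro i
    induction i with
    | zero =>
      intro y hy
      rw [Subgroup.upperCentralSeries_zero, Subgroup.mem_bot] at hy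
      rw [hy]; exact Commute.one_right x
    | succ i ih =>
      intro y hy
      have hc : Commute x (x * y * x⁻¹ * y⁻¹) := by
        refine ih _ ?_
        have := inv_mem (Subgroup.mem_upperCentralSeries_succ_iff.1 hy x)
        simpa [commutatorElement_def, mul_assoc] using this
      set c := x * y * x⁻¹ * y⁻¹ with hcdef
      have h1 : ∀ m : ℕ, x ^ m * y * (x ^ m)⁻¹ = c ^ m * y := by
        intro m
        induction m with
        | zero => simp
        | succ m ihm =>
          have : x * y * x⁻¹ = c * y := by rw [hcdef]; group
          calc x ^ (m + 1) * y * (x ^ (m + 1))⁻¹ = x * (x ^ m * y * (x ^ m)⁻¹) * x⁻¹ := by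
                rw [pow_succ']; group
            _ = (x * c ^ m) * y * x⁻¹ := by rw [ihm]; group
            _ = c ^ m * (x * y * x⁻¹) := by rw [(hc.pow_right m).eq]; group
            _ = c ^ (m + 1) * y := by rw [this, pow_succ]; group
      have h2 := h1 n
      rw [← Subgroup.mem_center_iff.1 hx y, mul_inv_cancel_right, eq_comm, mul_eq_right] at h2
      have h3 : c = 1 := htf c (isOfFinOrder_iff_pow_eq_one.2 ⟨n, hn, h2⟩)
      rw [hcdef, mul_inv_eq_one, mul_inv_eq_iff_eq_mul] at h3
      exact h3
  obtain ⟨i, hi⟩ := Group.IsNilpotent.nilpotent G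
  refine Subgroup.mem_center_iff.2 fun y => (key i y (hi ▸ Subgroup.mem_top y)).eq.symm

theorem Subgroup.fg_of_fg_inf_of_fg_map {G Q : Type*} [Group G] [Group Q] (π : G →* Q)
    (H : Subgroup G) (h1 : (π.ker ⊓ H).FG) (h2 : (H.map π).FG) : H.FG := by
  classical
  obtain ⟨S, hS⟩ := h1
  obtain ⟨T, hT⟩ := h2
  have hl : ∀ t ∈ T, ∃ g ∈ H, π g = t := fun t ht => by
    have : t ∈ H.map π := hT ▸ Subgroup.subset_closure ht
    exact this
  choose! l hlH hl using hl
  refine ⟨S ∪ T.image l, le_antisymm ?_ fun x hx => ?_⟩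
  · rw [Subgroup.closure_le]
    intro y hy
    rcases Finset.mem_union.1 hy with hy | hy
    · exact ((hS ▸ Subgroup.subset_closure hy : y ∈ π.ker ⊓ H)).2
    · obtain ⟨t, ht, rfl⟩ := Finset.mem_image.1 hy
      exact hlH t ht
  · have h3 : H.map π ≤ (Subgroup.closure (T.image l : Set G)).map π := by
      rw [← hT, Subgroup.closure_le]
      intro t ht
      exact ⟨l t, Subgroup.subset_closure (Finset.mem_coe.2 (Finset.mem_image_of_mem l ht)), hl t ht⟩
    obtain ⟨y, hy, hxy⟩ := h3 ⟨x, hx, rfl⟩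
    have hyH : y ∈ H := by
      refine (Subgroup.closure_le H).2 ?_ hy
      intro z hz
      obtain ⟨t, ht, rfl⟩ := Finset.mem_image.1 (Finset.mem_coe.1 hz)
      exact hlH t ht
    have hk : x * y⁻¹ ∈ Subgroup.closure (S : Set G) := by
      rw [hS]
      refine Subgroup.mem_inf.2 ⟨?_, mul_mem hx (inv_mem hyH)⟩
      rw [MonoidHom.mem_ker, map_mul, map_inv, hxy, mul_inv_cancel]
    rw [← inv_mul_cancel_right x y]
    exact mul_mem (Subgroup.closure_mono (by simp) hk) (Subgroup.closure_mono (by simp) hy)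

theorem Subgroup.fg_of_commGroup {Z : Type*} [CommGroup Z] (hZ : Group.FG Z) (H : Subgroup Z) :
    H.FG := by
  have : Module.Finite ℤ (Additive Z) :=
    Module.Finite.iff_addGroup_fg.2 (AddGroup.fg_iff_mul_fg.2 (show Group.FG Z from hZ))
  have h := IsNoetherian.noetherian (AddSubgroup.toIntSubmodule H.toAddSubgroup)
  rw [Submodule.fg_iff_addSubgroup_fg] at h
  exact (Subgroup.fg_iff_add_fg H).2 h

theorem Subgroup.fg_of_le_center {G : Type*} [Group G] {L : Subgroup G} (hL : L ≤ Subgroup.center G)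
    (hfg : L.FG) {H : Subgroup G} (hH : H ≤ L) : H.FG := by
  let _ : CommGroup L :=
    { (inferInstance : Group L) with
      mul_comm := fun a b => Subtype.ext (Subgroup.mem_center_iff.1 (hL b.2) a) }
  have h := Subgroup.fg_of_commGroup (Z := L) ((Group.fg_iff_subgroup_fg L).2 hfg) (H.subgroupOf L)
  have h2 : ((H.subgroupOf L).map L.subtype).FG := by
    obtain ⟨S, hS⟩ := h
    classical
    refine ⟨S.image L.subtype, ?_⟩
    rw [Finset.coe_image, ← MonoidHom.map_closure, hS]
  rwa [Subgroup.map_subgroupOf_eq_of_le hH] at h2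

/-- Here `L`, the last possibly nontrivial term, is central, so `[p, g]` is multiplicative in each
variable for `p` in the preceding term `N`. Commutators of lifts of generators of `N / L` with
generators of `G` therefore generate `L`. -/
theorem Subgroup.fg_lowerCentralSeries_succ {G : Type*} [Group G] (hG : Group.FG G) (c : ℕ)
    (hc : (⊤ : Subgroup G).lowerCentralSeries (c + 2) = ⊥)
    (hq : (((⊤ : Subgroup G).lowerCentralSeries c).map
      (QuotientGroup.mk' ((⊤ : Subgroup G).lowerCentralSeries (c + 1)))).FG) :
    ((⊤ : Subgroup G).lowerCentralSeries (c + 1)).FG := by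
  classical
  let L := (⊤ : Subgroup G).lowerCentralSeries (c + 1)
  let N := (⊤ : Subgroup G).lowerCentralSeries c
  have hLc : L ≤ Subgroup.center G := by
    intro x hx
    refine Subgroup.mem_center_iff.2 fun g => ?_
    have : ⁅x, g⁆ ∈ (⊤ : Subgroup G).lowerCentralSeries (c + 2) :=
      Subgroup.commutator_mem_commutator hx (Subgroup.mem_top g)
    rw [hc, Subgroup.mem_bot, commutatorElement_eq_one_iff_mul_comm] at this
    exact this.symm
  have hNL : ∀ p ∈ N, ∀ g, ⁅p, g⁆ ∈ L := fun p hp g =>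
    Subgroup.commutator_mem_commutator hp (Subgroup.mem_top g)
  have hconj : ∀ p ∈ N, ∀ g h, h * ⁅p, g⁆ * h⁻¹ = ⁅p, g⁆ := fun p hp g h => by
    rw [Subgroup.mem_center_iff.1 (hLc (hNL p hp g)) h, mul_inv_cancel_right]
  have hr : ∀ p ∈ N, ∀ g h, ⁅p, g * h⁆ = ⁅p, g⁆ * ⁅p, h⁆ := fun p hp g h => by
    rw [← hconj p hp h g, commutatorElement_def, commutatorElement_def, commutatorElement_def]; group
  have hl : ∀ p ∈ N, ∀ q ∈ N, ∀ g, ⁅p * q, g⁆ = ⁅q, g⁆ * ⁅p, g⁆ := fun p _ q hq g => by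
    rw [← hconj q hq g p]; simp only [commutatorElement_def]; group
  obtain ⟨S, hS⟩ := Group.fg_def.1 hG
  obtain ⟨T, hT⟩ := hq
  have hlift : ∀ t ∈ T, ∃ g ∈ N, QuotientGroup.mk' L g = t := fun t ht => by
    have : t ∈ N.map (QuotientGroup.mk' L) := hT ▸ Subgroup.subset_closure ht
    exact this
  choose! l hlN hlT using hlift
  let B := Subgroup.closure ((Finset.image₂ (fun t s => ⁅l t, s⁆) T S : Finset G) : Set G)
  -- `K` contains the lifts and also `L`, whose commutators are trivial; hence it is all of `N`.
  let K : Subgroup G :=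
    { carrier := {p | p ∈ N ∧ ∀ g, ⁅p, g⁆ ∈ B}
      one_mem' := ⟨one_mem N, fun g => by rw [commutatorElement_one_left]; exact one_mem B⟩
      mul_mem' := fun {p q} hp hq => ⟨mul_mem hp.1 hq.1, fun g => by
        rw [hl p hp.1 q hq.1]; exact mul_mem (hq.2 g) (hp.2 g)⟩
      inv_mem' := fun {p} hp => ⟨inv_mem hp.1, fun g => by
        have h := hl p hp.1 p⁻¹ (inv_mem hp.1) g
        rw [mul_inv_cancel, commutatorElement_one_left] at h
        rw [eq_inv_of_mul_eq_one_left h.symm]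
        exact inv_mem (hp.2 g)⟩ }
  have hlK : ∀ t ∈ T, l t ∈ K := fun t ht => by
    refine ⟨hlN t ht, fun g => ?_⟩
    let f : G →* G := MonoidHom.mk' (fun g => ⁅l t, g⁆) (hr (l t) (hlN t ht))
    have : Subgroup.closure (S : Set G) ≤ B.comap f := (Subgroup.closure_le _).2 fun s hs =>
      Subgroup.subset_closure (Finset.mem_coe.2 (Finset.mem_image₂_of_mem ht hs))
    exact this (hS ▸ Subgroup.mem_top g)
  have hLK : L ≤ K := fun p hp => by
    refine ⟨Subgroup.lowerCentralSeries_antitone _ (Nat.le_succ c) hp, fun g => ?_⟩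
    rw [commutatorElement_eq_one_iff_mul_comm.2 (Subgroup.mem_center_iff.1 (hLc hp) g).symm]
    exact one_mem B
  have hNK : N ≤ K := by
    have h1 : N.map (QuotientGroup.mk' L) ≤ K.map (QuotientGroup.mk' L) := by
      rw [← hT, Subgroup.closure_le]
      exact fun t ht => ⟨l t, hlK t ht, hlT t ht⟩
    rw [Subgroup.map_le_map_iff, QuotientGroup.ker_mk', sup_eq_left.2 hLK] at h1
    exact h1
  have hLB : L ≤ B := Subgroup.commutator_le.2 fun p hp g _ => (hNK hp).2 g
  refine ⟨_, le_antisymm ((Subgroup.closure_le _).2 fun x hx => ?_) hLB⟩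
  obtain ⟨t, ht, s, _, rfl⟩ := Finset.mem_image₂.1 (Finset.mem_coe.1 hx)
  exact hNL _ (hlN t ht) s

/-- Induction on the class: `H` is an extension of its image in `G / L` by `H ⊓ L`, a subgroup of a
finitely generated central group. -/
theorem Group.IsNilpotent.subgroup_fg {G : Type*} [Group G] [Group.IsNilpotent G] (hG : Group.FG G)
    (H : Subgroup G) : H.FG := by
  obtain ⟨c, hc⟩ := Subgroup.nilpotent_iff_lowerCentralSeries.1 (‹Group.IsNilpotent G›)
  have hc' : (⊤ : Subgroup G).lowerCentralSeries (c + 1) = ⊥ :=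
    le_bot_iff.1 (hc ▸ Subgroup.lowerCentralSeries_antitone _ (Nat.le_succ c))
  clear hc
  induction c generalizing G with
  | zero =>
    have hcen : (⊤ : Subgroup G) ≤ Subgroup.center G := fun x _ =>
      Subgroup.mem_center_iff.2 fun g => (commutatorElement_eq_one_iff_mul_comm.1 (by
        have : ⁅g, x⁆ ∈ (⊤ : Subgroup G).lowerCentralSeries (0 + 1) :=
          Subgroup.commutator_mem_commutator (Subgroup.mem_top g) (Subgroup.mem_top x)
        rwa [hc', Subgroup.mem_bot] at this))
    exact Subgroup.fg_of_le_center hcen (Group.fg_def.1 hG) le_top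
  | succ c ih =>
    let L := (⊤ : Subgroup G).lowerCentralSeries (c + 1)
    have hbot : (⊤ : Subgroup (G ⧸ L)).lowerCentralSeries (c + 1) = ⊥ := by
      have h := Subgroup.map_lowerCentralSeries (⊤ : Subgroup G) (QuotientGroup.mk' L) (c + 1)
      rw [← MonoidHom.range_eq_map, QuotientGroup.range_mk'] at h
      rw [← h, ← le_bot_iff, Subgroup.map_le_iff_le_comap, MonoidHom.comap_bot,
        QuotientGroup.ker_mk']
    have hQ : ∀ H' : Subgroup (G ⧸ L), H'.FG := fun H' => ih (QuotientGroup.fg L) H' hbot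
    have hL : L.FG := Subgroup.fg_lowerCentralSeries_succ hG c hc' (hQ _)
    have hLc : L ≤ Subgroup.center G := fun x hx => Subgroup.mem_center_iff.2 fun g => by
      have : ⁅x, g⁆ ∈ (⊤ : Subgroup G).lowerCentralSeries (c + 1 + 1) :=
        Subgroup.commutator_mem_commutator hx (Subgroup.mem_top g)
      rw [hc', Subgroup.mem_bot, commutatorElement_eq_one_iff_mul_comm] at this
      exact this.symm
    refine Subgroup.fg_of_fg_inf_of_fg_map (QuotientGroup.mk' L) H ?_ (hQ _)
    rw [QuotientGroup.ker_mk']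
    exact Subgroup.fg_of_le_center hLc hL inf_le_left

/-- Induction along `G → G / Z(G)`. The quotient stays torsion free by
`mem_center_of_pow_mem_center`, and the centre is finitely generated and torsion free, hence free
abelian of finite rank. -/
theorem isPolyInfiniteCyclic_of_isNilpotent {G : Type v} [Group G] [Group.IsNilpotent G]
    (hfg : Group.FG G) (htf : ∀ x : G, IsOfFinOrder x → x = 1) : IsPolyInfiniteCyclic G := by
  revert hfg htf
  refine Group.nilpotent_center_quotient_ind (P := fun G _ _ => Group.FG G →
    (∀ x : G, IsOfFinOrder x → x = 1) → IsPolyInfiniteCyclic G) G ?_ ?_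
  · intro G _ _ _ _
    exact .of_subsingleton G
  · intro G _ _ ih hfg htf
    have hQ : IsPolyInfiniteCyclic (G ⧸ Subgroup.center G) := by
      refine ih (QuotientGroup.fg _) fun x hx => ?_
      induction x using QuotientGroup.induction_on with | H g => ?_
      obtain ⟨n, hn, h⟩ := isOfFinOrder_iff_pow_eq_one.1 hx
      rw [← QuotientGroup.mk_pow, QuotientGroup.eq_one_iff] at h
      exact (QuotientGroup.eq_one_iff g).2 (mem_center_of_pow_mem_center htf hn h)
    refine hQ.of_surjective (QuotientGroup.mk' _) (QuotientGroup.mk'_surjective _) ?_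
    have hZ : IsPolyInfiniteCyclic (Subgroup.center G) := by
      have hZ := (Group.fg_iff_subgroup_fg _).2
        (Group.IsNilpotent.subgroup_fg hfg (Subgroup.center G))
      let _ : CommGroup (Subgroup.center G) :=
        { (inferInstance : Group (Subgroup.center G)) with
          mul_comm := fun a b => Subtype.ext (Subgroup.mem_center_iff.1 b.2 a) }
      refine isPolyInfiniteCyclic_of_commGroup (Z := Subgroup.center G) hZ fun x hx => ?_
      exact Subtype.ext (htf x.1 (Submonoid.isOfFinOrder_coe.2 hx))
    exact hZ.of_mulEquiv (MulEquiv.subgroupCongr (QuotientGroup.ker_mk' _).symm)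

end Nilpotent

/-! ### Unipotent functions on torsion free nilpotent groups -/

section UnipotentFunction

open MonoidAlgebra

/-- The linear extension of a function on `G` to the group algebra. -/
noncomputable def linearExtension {G : Type*} (f : G → ℚ) : MonoidAlgebra ℚ G →ₗ[ℚ] ℚ :=
  Finsupp.linearCombination ℚ f ∘ₗ (MonoidAlgebra.coeffLinearEquiv ℚ).toLinearMap

theorem linearExtension_of {G : Type*} [Group G] (f : G → ℚ) (g : G) :
    linearExtension f (of ℚ G g) = f g := by
  simp [linearExtension]

theorem MonoidAlgebra.linearMap_ext_of {G M : Type*} [Group G] [AddCommGroup M] [Module ℚ M]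
    {f g : MonoidAlgebra ℚ G →ₗ[ℚ] M} (h : ∀ x, f (of ℚ G x) = g (of ℚ G x)) : f = g :=
  LinearMap.ext_on (MonoidAlgebra.span_range_of ℚ G) fun _ ⟨x, hx⟩ => hx ▸ h x

/-- A function on a group is unipotent if its linear extension kills a power of the augmentation
ideal. -/
def IsUnipotentFunction {G : Type*} [Group G] (f : G → ℚ) : Prop :=
  ∃ n : ℕ, ∀ a ∈ augmentationSubmodule ℚ G ^ (n + 1), linearExtension f a = 0

theorem IsUnipotentFunction.comp {G G' : Type*} [Group G] [Group G'] {f : G → ℚ}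
    (hf : IsUnipotentFunction f) (π : G' →* G) : IsUnipotentFunction (f ∘ π) := by
  obtain ⟨n, hn⟩ := hf
  refine ⟨n, fun a ha => ?_⟩
  have h1 : linearExtension (f ∘ π) =
      linearExtension f ∘ₗ (mapDomainAlgHom ℚ ℚ π).toLinearMap := by
    refine MonoidAlgebra.linearMap_ext_of fun x => ?_
    rw [linearExtension_of, LinearMap.comp_apply, AlgHom.toLinearMap_apply]
    simp only [of_apply, mapDomainAlgHom_apply, mapDomain_single]
    exact (linearExtension_of f (π x)).symm
  have h2 : (augmentationSubmodule ℚ G').map (mapDomainAlgHom ℚ ℚ π).toLinearMap ≤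
      augmentationSubmodule ℚ G := by
    rw [augmentationSubmodule, Submodule.map_span, Submodule.span_le]
    rintro _ ⟨_, ⟨g, rfl⟩, rfl⟩
    simp only [AlgHom.toLinearMap_apply, map_sub, map_one, of_apply, mapDomainAlgHom_apply,
      mapDomain_single]
    exact of_sub_one_mem_augmentationSubmodule ℚ (π g)
  rw [h1]
  refine hn _ (pow_le_pow_left' h2 _ ?_)
  rw [← Submodule.map_pow]
  exact Submodule.mem_map_of_mem ha

/-- An additive function vanishes on `(g - 1)(h - 1) = gh - g - h + 1`, hence on the square of the
augmentation ideal. -/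
theorem isUnipotentFunction_of_hom {G : Type*} [Group G] (τ : G →* Multiplicative ℤ) (q : ℚ) :
    IsUnipotentFunction fun g => q * ((τ g).toAdd : ℚ) := by
  refine ⟨1, fun a ha => ?_⟩
  suffices h : augmentationSubmodule ℚ G ^ (1 + 1) ≤
      LinearMap.ker (linearExtension fun g => q * ((τ g).toAdd : ℚ)) from h ha
  rw [pow_succ, pow_one, augmentationSubmodule, Submodule.span_mul_span, Submodule.span_le]
  rintro _ ⟨_, ⟨g, rfl⟩, _, ⟨h, rfl⟩, rfl⟩
  have : (of ℚ G g - 1) * (of ℚ G h - 1) = of ℚ G (g * h) - of ℚ G g - of ℚ G h + of ℚ G 1 := by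
    rw [map_mul, map_one]; noncomm_ring
  simp only [SetLike.mem_coe, LinearMap.mem_ker, this, map_sub, map_add, linearExtension_of]
  simp
  ring

/-! ### The weight filtration and its comparison with augmentation powers. -/

variable {G : Type*} [Group G]

/-- The filtration of `ℚ[H]` in which `h - 1` has weight `n + 1` when `h` lies in the `n`-th term
of the lower central series of `G`. -/
inductive WeightFiltration (H : Subgroup G) : ℕ → MonoidAlgebra ℚ H → Prop
  | of_zero (a : MonoidAlgebra ℚ H) : WeightFiltration H 0 a
  | of_sub_one (n : ℕ) (h : H) (hh : (h : G) ∈ (⊤ : Subgroup G).lowerCentralSeries n) :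
      WeightFiltration H (n + 1) (of ℚ H h - 1)
  | zero (n : ℕ) : WeightFiltration H n 0
  | add (n : ℕ) (a b : MonoidAlgebra ℚ H) : WeightFiltration H n a → WeightFiltration H n b →
      WeightFiltration H n (a + b)
  | mul (n m : ℕ) (a b : MonoidAlgebra ℚ H) : WeightFiltration H n a → WeightFiltration H m b →
      WeightFiltration H (n + m) (a * b)
  | mono (n m : ℕ) (a : MonoidAlgebra ℚ H) : n ≤ m → WeightFiltration H m a →
      WeightFiltration H n a

namespace WeightFiltration

variable {H : Subgroup G}

theorem mul_any {n : ℕ} {a : MonoidAlgebra ℚ H} (ha : WeightFiltration H n a)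
    (b : MonoidAlgebra ℚ H) : WeightFiltration H n (a * b) :=
  mul n 0 a b ha (of_zero b)

theorem smul {n : ℕ} {a : MonoidAlgebra ℚ H} (ha : WeightFiltration H n a) (q : ℚ) :
    WeightFiltration H n (q • a) := by
  have := ha.mul_any (algebraMap ℚ _ q)
  rwa [← Algebra.commutes, ← Algebra.smul_def] at this

theorem of_conj_sub_of [H.Normal] {n : ℕ} (y : G) (h : H)
    (hh : (h : G) ∈ (⊤ : Subgroup G).lowerCentralSeries n) :
    WeightFiltration H (n + 2) (of ℚ H (MulAut.conjNormal y h) - of ℚ H h) := by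
  have h1 : of ℚ H (MulAut.conjNormal y h) - of ℚ H h =
      (of ℚ H (MulAut.conjNormal y h * h⁻¹) - 1) * of ℚ H h := by
    rw [sub_mul, ← map_mul, inv_mul_cancel_right, one_mul]
  rw [h1]
  refine (of_sub_one (n + 1) _ ?_).mul_any _
  rw [Subgroup.coe_mul, MulAut.conjNormal_apply, Subgroup.coe_inv, Subgroup.lowerCentralSeries_succ,
    Subgroup.commutator_comm]
  exact Subgroup.commutator_mem_commutator (Subgroup.mem_top y) hh

/-- Conjugation moves `h` by a commutator lying one step further down the lower central series, and
a twisted Leibniz rule propagates the gain of one weight to products. Powers of the augmentation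
ideal of `H` alone would not give this gain, since `G` may act nontrivially on the abelianization of
`H`. -/
theorem conj_sub [H.Normal] {n : ℕ} {a : MonoidAlgebra ℚ H} (ha : WeightFiltration H n a) (y : G) :
    WeightFiltration H (n + 1)
      (mapDomainAlgHom ℚ ℚ (MulAut.conjNormal (H := H) y).toMonoidHom a - a) := by
  have hof : ∀ h : H, mapDomainAlgHom ℚ ℚ (MulAut.conjNormal (H := H) y).toMonoidHom (of ℚ H h) =
      of ℚ H (MulAut.conjNormal y h) := fun h => by simp
  induction ha with
  | of_zero a =>
    induction a using MonoidAlgebra.induction_on with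
    | of h =>
      rw [hof]
      exact mono _ _ _ (by omega) (of_conj_sub_of (n := 0) y h (Subgroup.mem_top _))
    | add a b ha hb =>
      rw [map_add, add_sub_add_comm]
      exact add _ _ _ ha hb
    | smul q a ha =>
      rw [map_smul, ← smul_sub]
      exact ha.smul q
  | of_sub_one n h hh =>
    rw [map_sub, hof, map_one, sub_sub_sub_cancel_right]
    exact of_conj_sub_of y h hh
  | zero n => rw [map_zero, sub_zero]; exact zero _
  | add n a b _ _ ha hb =>
    rw [map_add, add_sub_add_comm]
    exact add _ _ _ ha hb
  | mul n m a b ha hb iha ihb =>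
    set ξ := mapDomainAlgHom ℚ ℚ (MulAut.conjNormal (H := H) y).toMonoidHom
    have : ξ (a * b) - a * b = ((ξ a - a) * (ξ b - b) + (ξ a - a) * b) + a * (ξ b - b) := by
      rw [map_mul]; noncomm_ring
    rw [this]
    refine add _ _ _ (add _ _ _ ?_ ?_) ?_
    · exact mono _ _ _ (by omega) (mul _ _ _ _ iha ihb)
    · exact mono _ _ _ (by omega) (mul _ _ _ _ iha hb)
    · exact mono _ _ _ (by omega) (mul _ _ _ _ ha ihb)
  | mono n m a hnm _ ih => exact mono _ _ _ (by omega) ih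

end WeightFiltration

/-- The factor `⊤` matters at exponent 0: the zeroth power of a submodule is only the line of
scalars, not the whole algebra. -/
theorem top_mul_augmentationSubmodule_pow_antitone (k : Type*) [CommRing k] {i j : ℕ} (h : i ≤ j) :
    (⊤ : Submodule k (MonoidAlgebra k G)) * augmentationSubmodule k G ^ j ≤
      ⊤ * augmentationSubmodule k G ^ i := by
  obtain ⟨d, rfl⟩ := Nat.exists_eq_add_of_le h
  rw [add_comm, pow_add, ← mul_assoc]
  exact mul_le_mul_left le_top _

theorem top_mul_augmentationSubmodule_pow_mul (k : Type*) [CommRing k] (i j : ℕ) :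
    ((⊤ : Submodule k (MonoidAlgebra k G)) * augmentationSubmodule k G ^ i) *
      (⊤ * augmentationSubmodule k G ^ j) ≤ ⊤ * augmentationSubmodule k G ^ (i + j) := by
  have h : augmentationSubmodule k G ^ i * ⊤ ≤ ⊤ * augmentationSubmodule k G ^ i := by
    cases i with
    | zero => simp
    | succ i => rw [augmentationSubmodule_pow_mul_top, top_mul_augmentationSubmodule_pow]
  calc _ = ⊤ * (augmentationSubmodule k G ^ i * ⊤) * augmentationSubmodule k G ^ j := by
        simp only [mul_assoc]
    _ ≤ ⊤ * (⊤ * augmentationSubmodule k G ^ i) * augmentationSubmodule k G ^ j :=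
        mul_le_mul_left (mul_le_mul_right h _) _
    _ = (⊤ * ⊤) * augmentationSubmodule k G ^ (i + j) := by simp only [mul_assoc, pow_add]
    _ ≤ _ := mul_le_mul_left le_top _

/-- A nonzero generator `h - 1` can be charged weight at most `c + 1`, so weight `n` forces at least
`⌈n / (c + 1)⌉` augmentation factors; `(n + c) / (c + 1)` is that ceiling. -/
theorem WeightFiltration.mem_augmentationSubmodule_pow {H : Subgroup G} {c : ℕ}
    (hc : (⊤ : Subgroup G).lowerCentralSeries (c + 1) = ⊥) {n : ℕ} {a : MonoidAlgebra ℚ H}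
    (ha : WeightFiltration H n a) :
    a ∈ ⊤ * augmentationSubmodule ℚ H ^ ((n + c) / (c + 1)) := by
  induction ha with
  | of_zero a =>
    rw [zero_add, Nat.div_eq_of_lt (Nat.lt_succ_self c), pow_zero, mul_one]
    trivial
  | of_sub_one n h hh =>
    by_cases hn : n ≤ c
    · have h1 : of ℚ H h - 1 ∈ ⊤ * augmentationSubmodule ℚ H ^ 1 := by
        rw [pow_one, top_mul_augmentationSubmodule]
        exact of_sub_one_mem_augmentationSubmodule ℚ h
      refine top_mul_augmentationSubmodule_pow_antitone ℚ ?_ h1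
      exact Nat.le_of_lt_succ ((Nat.div_lt_iff_lt_mul (Nat.succ_pos c)).2 (by omega))
    · have h1 := Subgroup.lowerCentralSeries_antitone (⊤ : Subgroup G) (by omega : c + 1 ≤ n) hh
      rw [hc, Subgroup.mem_bot] at h1
      rw [show h = 1 from Subtype.ext h1, map_one, sub_self]
      exact Submodule.zero_mem _
  | zero n => exact Submodule.zero_mem _
  | add n a b _ _ ha hb => exact Submodule.add_mem _ ha hb
  | mul n m a b _ _ ha hb =>
    refine top_mul_augmentationSubmodule_pow_antitone ℚ ?_
      (top_mul_augmentationSubmodule_pow_mul ℚ _ _ (Submodule.mul_mem_mul ha hb))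
    have h1 := Nat.div_add_mod (n + c) (c + 1)
    have h2 := Nat.div_add_mod (m + c) (c + 1)
    have h3 : (n + c) % (c + 1) < c + 1 := Nat.mod_lt _ (Nat.succ_pos c)
    have h4 : (m + c) % (c + 1) < c + 1 := Nat.mod_lt _ (Nat.succ_pos c)
    refine Nat.le_of_lt_succ ((Nat.div_lt_iff_lt_mul (Nat.succ_pos c)).2 ?_)
    rw [Nat.succ_mul, add_mul, Nat.succ_eq_add_one]
    rw [mul_comm (c + 1)] at h1 h2
    omega
  | mono n m a hnm _ ih =>
    exact top_mul_augmentationSubmodule_pow_antitone ℚ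
      (Nat.div_le_div_right (Nat.add_le_add_right hnm c)) ih

/-! ### Projection onto the kernel of a homomorphism to `ℤ`. -/

theorem kerProjection_mem (τ : G →* Multiplicative ℤ) {x : G} (hx : τ x = Multiplicative.ofAdd 1)
    (g : G) : g * x ^ (-(τ g).toAdd) ∈ τ.ker := by
  rw [MonoidHom.mem_ker, map_mul, map_zpow, hx, ← ofAdd_zsmul, smul_eq_mul, mul_one, ofAdd_neg,
    ofAdd_toAdd, mul_inv_cancel]

variable (τ : G →* Multiplicative ℤ) {x : G} (hx : τ x = Multiplicative.ofAdd 1)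

/-- The projection `G → ker τ` along the powers of an element `x` with `τ x = 1`. -/
def kerProjection (g : G) : τ.ker := ⟨g * x ^ (-(τ g).toAdd), kerProjection_mem τ hx g⟩

theorem kerProjection_mul_zpow (g : G) : (kerProjection τ hx g : G) * x ^ (τ g).toAdd = g := by
  simp [kerProjection]

theorem kerProjection_mul (g g' : G) : kerProjection τ hx (g * g') =
    kerProjection τ hx g * MulAut.conjNormal (x ^ (τ g).toAdd) (kerProjection τ hx g') := by
  refine Subtype.ext ?_
  rw [Subgroup.coe_mul, MulAut.conjNormal_apply]
  simp only [kerProjection, map_mul, toAdd_mul, neg_add, zpow_add, zpow_neg]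
  have : Commute (x ^ (τ g).toAdd)⁻¹ (x ^ (τ g').toAdd)⁻¹ :=
    (((Commute.refl x).zpow_zpow _ _).inv_left).inv_right
  rw [this.eq]
  group

/-- With `ξ` the conjugation by `x ^ τ g`, the crossed-product rule `kerProjection_mul` sends `(g -
1) b` to `(π g - 1) ξ(π b) + (ξ(π b) - π b)`. The first term gains a weight from its factor, the
second from `conj_sub`. -/
theorem weightFiltration_mapDomain_kerProjection {n : ℕ} {a : MonoidAlgebra ℚ G}
    (ha : a ∈ augmentationSubmodule ℚ G ^ n) :
    WeightFiltration τ.ker n (mapDomainLinearMap ℚ ℚ (kerProjection τ hx) a) := by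
  set π := mapDomainLinearMap ℚ ℚ (kerProjection τ hx) with hπ
  have hof : ∀ g, π (of ℚ G g) = of ℚ τ.ker (kerProjection τ hx g) := fun g => by
    rw [hπ, of_apply, mapDomainLinearMap_single, of_apply]
  induction n generalizing a with
  | zero => exact .of_zero _
  | succ n ih =>
    rw [pow_succ'] at ha
    refine Submodule.mul_induction_on ha (fun i hi b hb => ?_) fun b c hb hc => ?_
    · induction hi using Submodule.span_induction with
      | mem i hi =>
        obtain ⟨g, rfl⟩ := hi
        let ξ := mapDomainAlgHom ℚ ℚ (MulAut.conjNormal (H := τ.ker) (x ^ (τ g).toAdd)).toMonoidHom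
        have h1 : π (of ℚ G g * b) = of ℚ τ.ker (kerProjection τ hx g) * ξ (π b) := by
          have : π ∘ₗ LinearMap.mulLeft ℚ (of ℚ G g) =
              LinearMap.mulLeft ℚ (of ℚ τ.ker (kerProjection τ hx g)) ∘ₗ ξ.toLinearMap ∘ₗ π := by
            refine MonoidAlgebra.linearMap_ext_of fun g' => ?_
            simp only [LinearMap.comp_apply, LinearMap.mulLeft_apply, ← map_mul, hof,
              AlgHom.toLinearMap_apply, kerProjection_mul]
            rw [map_mul]
            congr 1
            simp [ξ]
          exact LinearMap.congr_fun this b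
        have h2 : π ((of ℚ G g - 1) * b) = (of ℚ τ.ker (kerProjection τ hx g) - 1) * (ξ (π b)) +
            (ξ (π b) - π b) := by
          rw [sub_mul, map_sub, h1, one_mul]; noncomm_ring
        have h3 := (ih hb).conj_sub (x ^ (τ g).toAdd)
        rw [h2]
        refine .add _ _ _ ?_ h3
        rw [add_comm n 1]
        refine .mul _ _ _ _ (.of_sub_one 0 _ (Subgroup.mem_top _)) ?_
        rw [← sub_add_cancel (ξ (π b)) (π b)]
        exact .add _ _ _ (.mono _ _ _ (Nat.le_succ n) h3) (ih hb)
      | zero => rw [zero_mul, map_zero]; exact .zero _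
      | add i j _ _ hi hj => rw [add_mul, map_add]; exact .add _ _ _ hi hj
      | smul q i _ hi => rw [smul_mul_assoc, map_smul]; exact hi.smul q
    · rw [map_add]; exact .add _ _ _ hb hc

theorem IsUnipotentFunction.comp_kerProjection (hG : Group.IsNilpotent G) {f : τ.ker → ℚ}
    (hf : IsUnipotentFunction f) : IsUnipotentFunction (f ∘ kerProjection τ hx) := by
  obtain ⟨n, hn⟩ := hf
  obtain ⟨c, hc⟩ := Subgroup.nilpotent_iff_lowerCentralSeries.1 hG
  have hc' : (⊤ : Subgroup G).lowerCentralSeries (c + 1) = ⊥ :=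
    le_bot_iff.1 (hc ▸ Subgroup.lowerCentralSeries_antitone _ (Nat.le_succ c))
  -- Weight `(c + 1) * (n + 1)` already guarantees `n + 1` augmentation factors; the definition
  -- supplies one more.
  refine ⟨(c + 1) * (n + 1), fun a ha => ?_⟩
  have h1 : linearExtension (f ∘ kerProjection τ hx) =
      linearExtension f ∘ₗ mapDomainLinearMap ℚ ℚ (kerProjection τ hx) := by
    refine MonoidAlgebra.linearMap_ext_of fun g => ?_
    rw [linearExtension_of, LinearMap.comp_apply, of_apply, mapDomainLinearMap_single]
    exact (linearExtension_of f _).symm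
  rw [h1]
  refine hn _ ?_
  rw [← top_mul_augmentationSubmodule_pow]
  refine top_mul_augmentationSubmodule_pow_antitone ℚ ?_
    ((weightFiltration_mapDomain_kerProjection τ hx ha).mem_augmentationSubmodule_pow hc')
  rw [Nat.le_div_iff_mul_le (Nat.succ_pos c), mul_comm, Nat.succ_eq_add_one]
  omega

/-- Unipotent functions detect the subgroups of `ℓ`-power exponent of a nilpotent
poly-infinite-cyclic group. -/
theorem IsPolyInfiniteCyclic.exists_unipotentFunctions {G : Type v} [Group G]
    (hG : IsPolyInfiniteCyclic G) (hnil : Group.IsNilpotent G) (ℓ : ℕ) [Fact ℓ.Prime] (a : ℕ)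
    (N : Subgroup G) (hN : ∀ g : G, g ^ ℓ ^ a ∈ N) :
    ∃ S : Set (G → ℚ), S.Finite ∧ (∀ f ∈ S, IsUnipotentFunction f) ∧
      ∀ γ : G, (∀ f ∈ S, ‖(f γ : ℚ_[ℓ]) - (f 1 : ℚ_[ℓ])‖ ≤ 1) → γ ∈ N := by
  induction hG with
  | of_subsingleton G =>
    exact ⟨∅, Set.finite_empty, by simp, fun γ _ => Subsingleton.elim 1 γ ▸ one_mem N⟩
  | of_ker G τ hτ _ ih =>
    obtain ⟨S, hSf, hSu, hS⟩ := ih inferInstance (N.subgroupOf τ.ker) fun g => by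
      rw [Subgroup.mem_subgroupOf, Subgroup.coe_pow]; exact hN g
    obtain ⟨x, hx⟩ := hτ (Multiplicative.ofAdd 1)
    -- The new function is `ℓ`-adically integral at `γ` exactly when `ℓ ^ a` divides `τ γ`; then `x
    -- ^ τ γ` is a power of `x ^ ℓ ^ a`, which lies in `N`.
    refine ⟨insert (fun g => ((ℓ : ℚ) ^ a)⁻¹ * ((τ g).toAdd : ℚ))
      ((fun f => f ∘ kerProjection τ hx) '' S), (hSf.image _).insert _, ?_, ?_⟩
    · rintro f (rfl | ⟨f, hf, rfl⟩)
      · exact isUnipotentFunction_of_hom τ _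
      · exact (hSu f hf).comp_kerProjection τ hx hnil
    · intro γ hγ
      rw [← kerProjection_mul_zpow τ hx γ]
      refine mul_mem (hS (kerProjection τ hx γ) fun f hf => ?_) ?_
      · have h1 : kerProjection τ hx 1 = 1 := Subtype.ext (by simp [kerProjection])
        have h2 := hγ _ (Set.mem_insert_of_mem _ ⟨f, hf, rfl⟩)
        simpa only [Function.comp_apply, h1] using h2
      · have h1 := hγ _ (Set.mem_insert _ _)
        have hℓ : (0 : ℝ) < ℓ := by exact_mod_cast (Fact.out : ℓ.Prime).pos
        simp only [map_one, toAdd_one, Int.cast_zero, mul_zero, Rat.cast_zero, sub_zero,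
          Rat.cast_mul, Rat.cast_inv, Rat.cast_pow, Rat.cast_natCast, Rat.cast_intCast, norm_mul,
          norm_inv, norm_pow, Padic.norm_p, inv_pow, inv_inv] at h1
        have h2 : ‖(((τ γ).toAdd : ℤ) : ℚ_[ℓ])‖ ≤ (ℓ : ℝ) ^ (-a : ℤ) := by
          rw [zpow_neg, zpow_natCast, ← one_div, le_div_iff₀ (by positivity), mul_comm]
          exact h1
        obtain ⟨m, hm⟩ := (Padic.norm_int_le_pow_iff_dvd _ _).1 h2
        rw [hm, zpow_mul]
        exact zpow_mem (by exact_mod_cast hN x) m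

/-- A unipotent function on a finitely generated group is a matrix coefficient of a unipotent
representation. -/
theorem IsUnipotentFunction.exists_unipotentRep {Γ : Type v} [Group Γ] (hΓ : Group.FG Γ) {f : Γ → ℚ}
    (hf : IsUnipotentFunction f) : ∃ (A : UnipotentRep ℚ Γ) (w : A.V) (μ : A.V →ₗ[ℚ] ℚ),
      ∀ γ, μ (A.ρ γ w) = f γ := by
  obtain ⟨n, hn⟩ := hf
  let I := augmentationSubmodule ℚ Γ ^ (n + 1)
  have hI : ∀ a : MonoidAlgebra ℚ Γ, ∀ b ∈ I, a * b ∈ I := fun a b hb =>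
    (top_mul_augmentationSubmodule_pow ℚ Γ n).le (Submodule.mul_mem_mul Submodule.mem_top hb)
  have hI' : ∀ a : MonoidAlgebra ℚ Γ, ∀ b ∈ I, b * a ∈ I := fun a b hb =>
    (augmentationSubmodule_pow_mul_top ℚ Γ n).le (Submodule.mul_mem_mul hb Submodule.mem_top)
  have hfd : FiniteDimensional ℚ (MonoidAlgebra ℚ Γ ⧸ I) := by
    have := fg_range_of_augmentationSubmodule_pow_le_ker ℚ Γ hΓ I.mkQ n (Submodule.ker_mkQ I).ge
    rw [Submodule.range_mkQ] at this
    exact ⟨this⟩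
  -- The quotient algebra lives in the universe of `Γ`, while the objects of `UnipotentRep ℚ Γ` have
  -- underlying spaces in the universe of `ℚ`; coordinates transport it. The representation is left
  -- multiplication, with vector the class of 1 and linear form induced by `f`.
  let d := Module.finrank ℚ (MonoidAlgebra ℚ Γ ⧸ I)
  let e : (MonoidAlgebra ℚ Γ ⧸ I) ≃ₗ[ℚ] (Fin d → ℚ) := (Module.finBasis ℚ _).equivFun
  let R₀ : MonoidAlgebra ℚ Γ →ₐ[ℚ] Module.End ℚ (MonoidAlgebra ℚ Γ ⧸ I) :=
    AlgHom.ofLinearMap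
      { toFun := fun a => I.mapQ I (LinearMap.mulLeft ℚ a) (hI a)
        map_add' := fun a b => Submodule.linearMap_qext I (LinearMap.ext fun c =>
          congrArg I.mkQ (add_mul a b c))
        map_smul' := fun q a => Submodule.linearMap_qext I (LinearMap.ext fun c =>
          congrArg I.mkQ (smul_mul_assoc q a c)) }
      (Submodule.linearMap_qext I (LinearMap.ext fun c => congrArg I.mkQ (one_mul c)))
      (fun a b => Submodule.linearMap_qext I (LinearMap.ext fun c =>
        congrArg I.mkQ (mul_assoc a b c)))
  let R : MonoidAlgebra ℚ Γ →ₐ[ℚ] Module.End ℚ (Fin d → ℚ) :=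
    (e.conjAlgEquiv ℚ).toAlgHom.comp R₀
  have hR : ∀ a ∈ augmentationSubmodule ℚ Γ ^ (n + 1), R a = 0 := fun a ha => by
    have : R₀ a = 0 := by
      refine LinearMap.ext fun y => ?_
      obtain ⟨b, rfl⟩ := I.mkQ_surjective y
      exact (Submodule.Quotient.mk_eq_zero I).2 (hI' b a ha)
    rw [AlgHom.comp_apply, this, map_zero]
  let A : UnipotentRep ℚ Γ :=
    { V := Fin d → ℚ
      ρ := (R : MonoidAlgebra ℚ Γ →* Module.End ℚ (Fin d → ℚ)).comp (of ℚ Γ)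
      isUnipotent := exists_filtration_of_augmentationSubmodule_pow_le_ker R n hR }
  refine ⟨A, e (I.mkQ 1), I.liftQ (linearExtension f) (fun a ha => hn a ha) ∘ₗ e.symm.toLinearMap,
    fun γ => ?_⟩
  have h1 : A.ρ γ (e (I.mkQ 1)) = e (I.mkQ (of ℚ Γ γ)) := by
    change e (R₀ (of ℚ Γ γ) (e.symm (e (I.mkQ 1)))) = _
    rw [e.symm_apply_apply]
    change e (I.mkQ (of ℚ Γ γ * 1)) = _
    rw [mul_one]
  rw [h1, LinearMap.comp_apply, LinearEquiv.coe_coe, e.symm_apply_apply]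
  exact linearExtension_of f γ

end UnipotentFunction

/-! ### Injectivity -/

section Injective

open Filter Topology

variable {ℓ : ℕ} [Fact ℓ.Prime] {Γ : Type v} [Group Γ]

/-- On a finitely generated `ℓ`-regular group, finitely many unipotent functions detect any normal
subgroup with quotient a finite `ℓ`-group. -/
theorem IsLRegular.exists_unipotentFunctions (hreg : IsLRegular ℓ Γ) (hΓ : Group.FG Γ)
    (i : LIndex ℓ Γ) :
    ∃ S : Set (Γ → ℚ), S.Finite ∧ (∀ f ∈ S, IsUnipotentFunction f) ∧
      ∀ γ : Γ, (∀ f ∈ S, ‖(f γ : ℚ_[ℓ]) - (f 1 : ℚ_[ℓ])‖ ≤ 1) → γ ∈ i.N := by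
  obtain ⟨M, hM, hMN, hnil, htf⟩ := hreg i.N i.finite i.isPGroup
  have := i.finite
  obtain ⟨a, ha⟩ := IsPGroup.iff_card.1 i.isPGroup
  have hpow : ∀ γ : Γ, γ ^ ℓ ^ a ∈ i.N := fun γ => by
    rw [← QuotientGroup.eq_one_iff, QuotientGroup.mk_pow, ← ha, pow_card_eq_one']
  obtain ⟨S, hSf, hSu, hS⟩ := (isPolyInfiniteCyclic_of_isNilpotent (QuotientGroup.fg M)
    htf).exists_unipotentFunctions hnil ℓ a (i.N.map (QuotientGroup.mk' M)) fun g => by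
      obtain ⟨γ, rfl⟩ := QuotientGroup.mk'_surjective M g
      exact ⟨_, hpow γ, map_pow _ _ _⟩
  refine ⟨(fun f => f ∘ QuotientGroup.mk' M) '' S, hSf.image _, ?_, fun γ hγ => ?_⟩
  · rintro _ ⟨f, hf, rfl⟩
    exact (hSu f hf).comp _
  · have h1 : QuotientGroup.mk' M γ ∈ i.N.map (QuotientGroup.mk' M) :=
      hS _ fun f hf => by
        have h := hγ (f ∘ QuotientGroup.mk' M) (Set.mem_image_of_mem _ hf)
        simpa only [Function.comp_apply, map_one] using h
    rw [← Subgroup.mem_comap, Subgroup.comap_map_eq, QuotientGroup.ker_mk', sup_eq_left.2 hMN] at h1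
    exact h1

/-- If `x` maps to 1, every unipotent function tends to its value at 1 along `proLFilter x`. So some
`γ` in the coset given by `x` at `i` satisfies all the detecting inequalities, and that coset is
trivial. -/
theorem injective_proLToUnipotentCompletion (hΓ : Group.FG Γ) (hreg : IsLRegular ℓ Γ) :
    Function.Injective (proLToUnipotentCompletion (Γ := Γ) ℓ hΓ) := by
  refine (injective_iff_map_eq_one _).2 fun x hx => Subtype.ext (funext fun i => ?_)
  obtain ⟨S, hSf, hSu, hS⟩ := hreg.exists_unipotentFunctions hΓ i
  have h1 : ∀ f ∈ S, ∀ᶠ γ in proLFilter x, ‖(f γ : ℚ_[ℓ]) - (f 1 : ℚ_[ℓ])‖ ≤ 1 := fun f hf => by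
    obtain ⟨A, w, μ, hA⟩ := (hSu f hf).exists_unipotentRep hΓ
    have h := tendsto_coeff_proLToUnipotentCompletion hΓ x A w μ
    rw [hx, ← map_one (toUnipotentCompletion ℚ Γ ℚ_[ℓ]),
      UnipotentCompletion.coeff_toUnipotentCompletion, eq_ratCast] at h
    simp only [hA] at h
    filter_upwards [Metric.tendsto_nhds.1 h 1 one_pos] with γ hγ
    rw [← dist_eq_norm]
    exact hγ.le
  obtain ⟨γ, hγ, hγx⟩ := (((eventually_all_finite hSf).2 h1).and
    ((proLFilter_hasBasis x).mem_of_mem (i := i) trivial)).exists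
  rw [← show (γ : Γ ⧸ i.N) = x.1 i from hγx, (QuotientGroup.eq_one_iff γ).2 (hS γ hγ)]
  rfl

end Injective

theorem mainTheorem11 (ℓ : ℕ) [Fact ℓ.Prime] (Γ : Type*) [Group Γ] (hfg : Group.FG Γ)
    (hreg : IsLRegular ℓ Γ) :
    ∃ φ : ProLCompletion ℓ Γ →* UnipotentCompletion ℚ Γ ℚ_[ℓ],
      (Continuous φ ∧ ∀ γ : Γ, φ (toProLCompletion ℓ Γ γ) = toUnipotentCompletion ℚ Γ ℚ_[ℓ] γ) ∧
      (∀ ψ : ProLCompletion ℓ Γ →* UnipotentCompletion ℚ Γ ℚ_[ℓ],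
        Continuous ψ →
        (∀ γ : Γ, ψ (toProLCompletion ℓ Γ γ) = toUnipotentCompletion ℚ Γ ℚ_[ℓ] γ) → ψ = φ) ∧
      Function.Injective φ := by
  refine ⟨proLToUnipotentCompletion ℓ hfg, ⟨continuous_proLToUnipotentCompletion hfg,
    proLToUnipotentCompletion_toProLCompletion hfg⟩, fun ψ hψ h => ?_,
    injective_proLToUnipotentCompletion hfg hreg⟩
  refine DFunLike.coe_injective (UnipotentCompletion.eq_of_continuous hψ
    (continuous_proLToUnipotentCompletion hfg) fun γ => ?_)
  rw [h, proLToUnipotentCompletion_toProLCompletion]
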